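/- **Setting.** Let $\phi(s)\in\mathbb{R}^d$ be feature vectors, $r(s)\in\mathbb{R}$ rewards, $\gamma\in\mathbb{R}$ the discount factor and $\alpha>0$ the learning rate. The TD(0) iterates along a state trajectory $\{s^k\}$ are $$\theta^{k+1}=\theta^k-\alpha\,\phi(s^k)\big((\phi(s^k)-\gamma\phi(s^{k+1}))^{T}\theta^k-r(s^k)\big).$$ Each transition $(s^k,s^{k+1})$ is encoded by $z^k\in\{1,\dots,n\}$, where the value $i$ encodes a pair $(s_i,s_i')$, and $\{z^k\}$ is a Markov chain with transition matrix $P=(p_{ij})$: for a filtration to which $\{z^k\}$ is adapted and for which $\theta^0$ is measurable at time $0$ and square integrable, the conditional probability of $z^{k+1}=j$ given the information at time $k$ is $p_{z^k j}$. Let $p_i^k=\mathbb{P}(z^k=i)$ and assume $p^k\to p^\infty$, a stationary distribution of $P$. For a fixed $\theta^*\in\mathbb{R}^d$ put $$A_i=\phi(s_i)(\gamma\phi(s_i')-\phi(s_i))^{T},\quad b_i=\phi(s_i)\big(r(s_i)+(\gamma\phi(s_i')-\phi(s_i))^{T}\theta^*\big),\quad \bar A=\sum_i p_i^\infty A_i,$$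 and assume that $\theta^*$ solves the projected Bellman equation in the form $\sum_i p^\infty_i b_i=0$, and that $\bar A$ is Hurwitz (all eigenvalues have negative real part). Let $q^k$ be the stacked vector of the $q^k_i=\mathbb{E}[(\theta^k-\theta^*)\mathbf 1_{\{z^k=i\}}]$, and $\mathrm{vec}(Q^k)$ the stacked vector of the $\mathrm{vec}(Q_i^k)$, $Q_i^k=\mathbb{E}[(\theta^k-\theta^*)(\theta^k-\theta^*)^{T}\mathbf 1_{\{z^k=i\}}]$. With $H_i=I_d+\alpha A_i$, let $$\mathcal H_{11}=(P^{T}\otimes I_d)\,\mathrm{diag}(H_i),\qquad \mathcal H_{22}=(P^{T}\otimes I_{d^2})\,\mathrm{diag}(H_i\otimes H_i),$$ let $\mathcal H_{21}$ be the block matrix whose $(j,i)$ block is $\alpha p_{ij}(b_i\otimes H_i+H_i\otimes b_i)$, and let $\mathcal H=\begin{bmatrix}\mathcal H_{11}&0\\ \mathcal H_{21}&\mathcal H_{22}\end{bmatrix}$. Let $b$ and $\hat B$ be the stacked vectors of the $b_i$ and of the $b_i\otimes b_i$, and let $\sigma$ denote the spectral radius. All of $\mathcal H,\mathcal H_{11},\mathcal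 H_{21},\mathcal H_{22}$ depend on $\alpha$. Set $$q^\infty=\alpha(I-\mathcal H_{11})^{-1}\big((P^{T}\mathrm{diag}(p_i^\infty))\otimes I_d\big)b,$$ $$\mathrm{vec}(Q^\infty)=\alpha^2(I-\mathcal H_{22})^{-1}\Big(\alpha^{-2}\mathcal H_{21}q^\infty+\big((P^{T}\mathrm{diag}(p_i^\infty))\otimes I_{d^2}\big)\hat B\Big),$$ $$\delta^\infty=(\mathbf 1_n^{T}\otimes \mathrm{vec}(I_d)^{T})\,\mathrm{vec}(Q^\infty).$$ **Claim.** 1. For every $\alpha>0$ with $\sigma(\mathcal H_{22})<1$: the matrices $I-\mathcal H_{11}$ and $I-\mathcal H_{22}$ are invertible, and as $k\to\infty$, $q^k\to q^\infty$, $\mathrm{vec}(Q^k)\to\mathrm{vec}(Q^\infty)$ and $\mathbb{E}\|\theta^k-\theta^*\|^2\to\delta^\infty$. 2. For every such $\alpha$: if moreover $\|p^k-p^\infty\|\le C\tilde\rho^{\,k}$ for all $k$, then for every $\epsilon>0$ there is a constant $C_0$ such that for all $k$ $$\delta^\infty-C_0\max\{\sigma(\mathcal H)+\epsilon,\tilde\rho\}^k\le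 \mathbb{E}\|\theta^k-\theta^*\|^2\le \delta^\infty+C_0\max\{\sigma(\mathcal H)+\epsilon,\tilde\rho\}^k .$$ 3. Suppose moreover that the chain is ergodic, i.e. $(P^k)_{ij}\to p_j^\infty$ for all $i,j$. Then, with everything but $\alpha$ fixed and $\alpha\to0^+$: $\sigma(\mathcal H_{22})<1$ for all sufficiently small $\alpha>0$, $\delta^\infty=O(\alpha)$, and $$\sigma(\mathcal H)=1+\mathrm{Re}(\lambda_{\max\mathrm{Re}}(\bar A))\,\alpha+o(\alpha),$$ where $\lambda_{\max\mathrm{Re}}(\bar A)$ is an eigenvalue of $\bar A$ with the largest real part. -/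

import Mathlib

open MeasureTheory Filter Topology Asymptotics
open scoped Kronecker

noncomputable section

namespace MarkovTD

section LinearAlgebra

/-- Spectral radius of a real square matrix: the largest modulus of its complex eigenvalues. -/
def specRad {m : Type*} [Fintype m] [DecidableEq m] (M : Matrix m m ℝ) : ℝ :=
  (spectralRadius ℂ (M.map ((↑) : ℝ → ℂ))).toReal

/-- All complex eigenvalues have strictly negative real part. -/
def IsHurwitz {m : Type*} [Fintype m] [DecidableEq m] (M : Matrix m m ℝ) : Prop :=
  ∀ l ∈ spectrum ℂ (M.map ((↑) : ℝ → ℂ)), l.re < 0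

/-- `l` is an eigenvalue of `M` with the largest real part. -/
def IsMaxReEigenvalue {m : Type*} [Fintype m] [DecidableEq m] (M : Matrix m m ℝ) (l : ℂ) : Prop :=
  l ∈ spectrum ℂ (M.map ((↑) : ℝ → ℂ)) ∧
    ∀ l' ∈ spectrum ℂ (M.map ((↑) : ℝ → ℂ)), l'.re ≤ l.re

/-- The block diagonal matrix `diag(H_i)`, with the block index as first index. -/
def blockDiag {N m : Type*} [DecidableEq N] (H : N → Matrix m m ℝ) : Matrix (N × m) (N × m) ℝ :=
  Matrix.of fun x y => if x.1 = y.1 then H x.1 x.2 y.2 else 0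

/-- `v ⊗ M` for a column vector `v`. -/
def colKron {l m n : Type*} (v : l → ℝ) (M : Matrix m n ℝ) : Matrix (l × m) n ℝ :=
  Matrix.of fun x e => v x.1 * M x.2 e

/-- `M ⊗ v` for a column vector `v`. -/
def kronCol {l m n : Type*} (M : Matrix m n ℝ) (v : l → ℝ) : Matrix (m × l) n ℝ :=
  Matrix.of fun x e => M x.1 e * v x.2

end LinearAlgebra

section JumpSystem

/-! Jump linear recursion `ξ ↦ (I + α A_i) ξ + α b_i` driven by a chain with transition matrix `P`
(`P i j` is the probability of jumping from `i` to `j`). -/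

variable {N : Type*} [Fintype N] [DecidableEq N] {d : ℕ}

/-- `H_i = I + α A_i`. -/
def Hi (A : N → Matrix (Fin d) (Fin d) ℝ) (α : ℝ) (i : N) : Matrix (Fin d) (Fin d) ℝ :=
  1 + α • A i

/-- `H₁₁ = (Pᵀ ⊗ I) diag(I + α A_i)`. -/
def H11 (P : Matrix N N ℝ) (A : N → Matrix (Fin d) (Fin d) ℝ) (α : ℝ) :
    Matrix (N × Fin d) (N × Fin d) ℝ :=
  (P.transpose ⊗ₖ (1 : Matrix (Fin d) (Fin d) ℝ)) * blockDiag (Hi A α)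

/-- `S(b_i, A_i) = b_i ⊗ (I + α A_i) + (I + α A_i) ⊗ b_i`. -/
def Sblock (A : N → Matrix (Fin d) (Fin d) ℝ) (b : N → Fin d → ℝ) (α : ℝ) (i : N) :
    Matrix (Fin d × Fin d) (Fin d) ℝ :=
  colKron (b i) (Hi A α i) + kronCol (Hi A α i) (b i)

/-- `H₂₁`, whose `(j, i)` block is `α p_{ij} S(b_i, A_i)`. -/
def H21 (P : Matrix N N ℝ) (A : N → Matrix (Fin d) (Fin d) ℝ) (b : N → Fin d → ℝ) (α : ℝ) :
    Matrix (N × (Fin d × Fin d)) (N × Fin d) ℝ :=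
  Matrix.of fun x y => α * (P y.1 x.1 * Sblock A b α y.1 x.2 y.2)

/-- `H₂₂ = (Pᵀ ⊗ I) diag((I + α A_i) ⊗ (I + α A_i))`. -/
def H22 (P : Matrix N N ℝ) (A : N → Matrix (Fin d) (Fin d) ℝ) (α : ℝ) :
    Matrix (N × (Fin d × Fin d)) (N × (Fin d × Fin d)) ℝ :=
  (P.transpose ⊗ₖ (1 : Matrix (Fin d × Fin d) (Fin d × Fin d) ℝ)) *
    blockDiag (fun i => Hi A α i ⊗ₖ Hi A α i)

/-- The full system matrix, lower block triangular with blocks `H₁₁`, `H₂₁`, `H₂₂`. -/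
def Hfull (P : Matrix N N ℝ) (A : N → Matrix (Fin d) (Fin d) ℝ) (b : N → Fin d → ℝ) (α : ℝ) :
    Matrix ((N × Fin d) ⊕ (N × (Fin d × Fin d))) ((N × Fin d) ⊕ (N × (Fin d × Fin d))) ℝ :=
  Matrix.fromBlocks (H11 P A α) 0 (H21 P A b α) (H22 P A α)

/-- The stacked vector of the `b_i`. -/
def bStack (b : N → Fin d → ℝ) : N × Fin d → ℝ := fun x => b x.1 x.2

/-- The stacked vector of the `b_i ⊗ b_i`. -/
def bbStack (b : N → Fin d → ℝ) : N × (Fin d × Fin d) → ℝ :=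
  fun x => b x.1 x.2.1 * b x.1 x.2.2

/-- `q^∞ = α (I - H₁₁)⁻¹ ((Pᵀ diag(π_i)) ⊗ I) b`. -/
def qInf (P : Matrix N N ℝ) (A : N → Matrix (Fin d) (Fin d) ℝ) (b : N → Fin d → ℝ) (π : N → ℝ)
    (α : ℝ) : N × Fin d → ℝ :=
  α • ((1 - H11 P A α)⁻¹).mulVec
    (((P.transpose * Matrix.diagonal π) ⊗ₖ (1 : Matrix (Fin d) (Fin d) ℝ)).mulVec (bStack b))

/-- `vec Q^∞ = α² (I - H₂₂)⁻¹ (α⁻² H₂₁ q^∞ + ((Pᵀ diag(π_i)) ⊗ I) B̂)`. -/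
def vecQInf (P : Matrix N N ℝ) (A : N → Matrix (Fin d) (Fin d) ℝ) (b : N → Fin d → ℝ) (π : N → ℝ)
    (α : ℝ) : N × (Fin d × Fin d) → ℝ :=
  α ^ 2 • ((1 - H22 P A α)⁻¹).mulVec
    ((α ^ 2)⁻¹ • (H21 P A b α).mulVec (qInf P A b π α) +
      ((P.transpose * Matrix.diagonal π) ⊗ₖ
        (1 : Matrix (Fin d × Fin d) (Fin d × Fin d) ℝ)).mulVec (bbStack b))

/-- `δ^∞ = (1_nᵀ ⊗ vec(I)ᵀ) vec Q^∞`. -/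
def deltaInf (P : Matrix N N ℝ) (A : N → Matrix (Fin d) (Fin d) ℝ) (b : N → Fin d → ℝ) (π : N → ℝ)
    (α : ℝ) : ℝ :=
  (fun x : N × (Fin d × Fin d) => (1 : ℝ) * Matrix.vec (1 : Matrix (Fin d) (Fin d) ℝ) x.2) ⬝ᵥ
    vecQInf P A b π α

/-- `Ā = ∑ π_i A_i`. -/
def Abar (A : N → Matrix (Fin d) (Fin d) ℝ) (π : N → ℝ) : Matrix (Fin d) (Fin d) ℝ :=
  ∑ i, π i • A i

end JumpSystem

section Chain

variable {Ω : Type*} [mΩ : MeasurableSpace Ω] {N S : Type*} {d : ℕ}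

/-- `z` is a Markov chain with transition matrix `P` relative to the filtration `ℱ`: it is adapted,
and given the information available at time `k` the next state is `j` with probability
`P (z k) j`. -/
structure IsMarkovChain (μ : Measure Ω) (ℱ : Filtration ℕ mΩ) (P : Matrix N N ℝ)
    (z : ℕ → Ω → N) : Prop where
  adapted : ∀ k i, MeasurableSet[ℱ k] (z k ⁻¹' {i})
  transition : ∀ k j, μ[(z (k + 1) ⁻¹' {j}).indicator (fun _ => (1 : ℝ)) | ℱ k]
    =ᵐ[μ] fun ω => P (z k ω) j

/-- `p^k`, the law of `z^k`. -/
def law (μ : Measure Ω) (z : ℕ → Ω → N) (k : ℕ) : N → ℝ := fun i => μ.real (z k ⁻¹' {i})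

/-- The TD(0) iterates with feature map `φ`, reward `r`, discount factor `γ`, learning rate `α`
along the state trajectory `s`. -/
def tdIter (φ : S → EuclideanSpace ℝ (Fin d)) (r : S → ℝ) (γ : ℝ) (s : ℕ → Ω → S)
    (θ₀ : Ω → EuclideanSpace ℝ (Fin d)) (α : ℝ) : ℕ → Ω → EuclideanSpace ℝ (Fin d)
  | 0 => θ₀
  | k + 1 => fun ω =>
      tdIter φ r γ s θ₀ α k ω -
        α • (inner ℝ (φ (s k ω) - γ • φ (s (k + 1) ω)) (tdIter φ r γ s θ₀ α k ω) - r (s k ω)) •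
          φ (s k ω)

/-- `A_i = φ(s) (γ φ(s') - φ(s))ᵀ` for the transition `i = (s, s')`. -/
def tdA (φ : S → EuclideanSpace ℝ (Fin d)) (γ : ℝ) (cur nxt : N → S) (i : N) :
    Matrix (Fin d) (Fin d) ℝ :=
  Matrix.of fun a c => φ (cur i) a * (γ * φ (nxt i) c - φ (cur i) c)

/-- `b_i = φ(s) (r(s) + (γ φ(s') - φ(s))ᵀ θ*)` for the transition `i = (s, s')`. -/
def tdb (φ : S → EuclideanSpace ℝ (Fin d)) (r : S → ℝ) (γ : ℝ)
    (θstar : EuclideanSpace ℝ (Fin d)) (cur nxt : N → S) (i : N) : Fin d → ℝ :=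
  fun a => φ (cur i) a * (r (cur i) + inner ℝ (γ • φ (nxt i) - φ (cur i)) θstar)

/-- `q^k`, the stacked vectors `q_i^k = 𝔼[ξ^k 1_{z^k = i}]`. -/
def qVec (μ : Measure Ω) (z : ℕ → Ω → N) (ξ : ℕ → Ω → EuclideanSpace ℝ (Fin d)) (k : ℕ) :
    N × Fin d → ℝ :=
  fun x => ∫ ω, (z k ⁻¹' {x.1}).indicator (fun ω => ξ k ω x.2) ω ∂μ

/-- `Q_i^k = 𝔼[ξ^k (ξ^k)ᵀ 1_{z^k = i}]`. -/
def Qmat (μ : Measure Ω) (z : ℕ → Ω → N) (ξ : ℕ → Ω → EuclideanSpace ℝ (Fin d)) (k : ℕ) (i : N) :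
    Matrix (Fin d) (Fin d) ℝ :=
  Matrix.of fun a c => ∫ ω, (z k ⁻¹' {i}).indicator (fun ω => ξ k ω a * ξ k ω c) ω ∂μ

/-- `vec Q^k`, the stacked vectors `vec Q_i^k`. -/
def vecQ (μ : Measure Ω) (z : ℕ → Ω → N) (ξ : ℕ → Ω → EuclideanSpace ℝ (Fin d)) (k : ℕ) :
    N × (Fin d × Fin d) → ℝ :=
  fun x => Matrix.vec (Qmat μ z ξ k x.1) x.2

end Chain

end MarkovTD

end

open MarkovTD

/-!
The modes `z k` and the error `ξ k = θ k - θ*` form a jump linear recursion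
`ξ (k + 1) = (I + α A_{z k}) ξ k + α b_{z k}`. Since `ξ (k + 1)` is a function of `ξ k` and `z k`, it
is known at time `k`, and the Markov property turns the mode-wise moments `q k` and `vec (Q k)` into
an exact affine recursion with matrix `Hfull` and an inhomogeneous term linear in the law of `z k`
(`qVec_succ`, `vecQ_succ`).

For a fixed learning rate everything follows once `σ(Hfull) < 1`. As `Hfull` is block triangular, only
`σ(H₁₁) < 1` is needed, and it follows from `σ(H₂₂) < 1` by a Cauchy–Schwarz argument: iterates of
`H₁₁` are dominated by the quadratic forms of iterates of `H₂₂` (`sq_H11_pow_le_blockQuad`,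
`specRad_H11_lt_one`). Gelfand's formula then gives convergence and the geometric rate
(`linearRecursion_tendsto_zero`, `linearRecursion_norm_le`).

For small learning rates, `H₁₁` and `H₂₂` are perturbations `K + α (E₀ + α E₁)` of `K = Pᵀ ⊗ I`. For an
ergodic chain, `K ^ k` converges to a projection `X L`, and to first order the relevant eigenvalues
are `1 + α ν` with `ν` an eigenvalue of the compression `L E₀ X`; this compression is `Ā` for `H₁₁`
and the Kronecker sum `Ā ⊗ I + I ⊗ Ā` for `H₂₂`. The upper bound comes from compactness of normalized
eigenvectors (`IsDominantSplitting.eventually_forall_norm_lt`), the lower bound from the maximum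
principle applied to the inverse of the determinant of a rescaled pencil that is regular at `α = 0`
(`IsDominantSplitting.eventually_exists_mem_spectrum`). The same pencil shows that the resolvents at
`1` are of order `α⁻¹`, with singular part acting through `X L`. Since `∑ π_i b_i = 0` removes the
singular part in `q^∞`, the stationary mean square error is `O(α)` (`deltaInf_isBigO`).
-/

namespace MarkovTD

/-! ### Spectral radius and linear recursions -/

section SpectralRadius

variable {m : Type*} [Fintype m] [DecidableEq m]

theorem mem_spectrum_iff_exists_mulVec_eq_smul {K : Type*} [Field K] (M : Matrix m m K) (l : K) :
    l ∈ spectrum K M ↔ ∃ v : m → K, v ≠ 0 ∧ M.mulVec v = l • v := by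
  rw [← Matrix.spectrum_toLin', ← Module.End.hasEigenvalue_iff_mem_spectrum]
  constructor
  · intro h
    obtain ⟨v, hv⟩ := h.exists_hasEigenvector
    exact ⟨v, hv.2, by simpa using hv.apply_eq_smul⟩
  · rintro ⟨v, hv, h⟩
    exact Module.End.hasEigenvalue_of_hasEigenvector
      (Module.End.hasEigenvector_iff.2 ⟨Module.End.mem_eigenspace_iff.2 (by simpa using h), hv⟩)

section Norms

open scoped Matrix.Norms.Operator

theorem spectralRadius_complexMatrix_ne_top (M : Matrix m m ℂ) : spectralRadius ℂ M ≠ ⊤ := by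
  rcases (spectrum ℂ M).eq_empty_or_nonempty with h | h
  · simp [spectralRadius, h]
  · obtain ⟨l, -, hl⟩ := spectrum.exists_nnnorm_eq_spectralRadius_of_nonempty h
    rw [← hl]
    exact ENNReal.coe_ne_top

theorem norm_le_specRad {M : Matrix m m ℝ} {l : ℂ}
    (hl : l ∈ spectrum ℂ (M.map ((↑) : ℝ → ℂ))) : ‖l‖ ≤ specRad M := by
  have h : (‖l‖₊ : ENNReal) ≤ spectralRadius ℂ (M.map ((↑) : ℝ → ℂ)) :=
    le_iSup₂ (f := fun (k : ℂ) (_ : k ∈ spectrum ℂ (M.map ((↑) : ℝ → ℂ))) => (‖k‖₊ : ENNReal)) l hl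
  have := ENNReal.toReal_mono (spectralRadius_complexMatrix_ne_top _) h
  simpa [specRad] using this

theorem specRad_nonneg (M : Matrix m m ℝ) : 0 ≤ specRad M := ENNReal.toReal_nonneg

/-- The spectral radius is `0` on an empty index type, hence the assumption `0 < r`. -/
theorem specRad_lt {M : Matrix m m ℝ} {r : ℝ} (hr : 0 < r)
    (h : ∀ l ∈ spectrum ℂ (M.map ((↑) : ℝ → ℂ)), ‖l‖ < r) : specRad M < r := by
  rcases (spectrum ℂ (M.map ((↑) : ℝ → ℂ))).eq_empty_or_nonempty with h0 | h0
  · simpa [specRad, spectralRadius, h0] using hr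
  · obtain ⟨l, hl, hl'⟩ := spectrum.exists_nnnorm_eq_spectralRadius_of_nonempty h0
    have := h l hl
    simpa [specRad, ← hl'] using this

/-- Gelfand's formula, read as a geometric bound on the powers of a real matrix. -/
theorem exists_norm_pow_mulVec_le (M : Matrix m m ℝ) {r : ℝ} (hr : specRad M < r) :
    ∃ C : ℝ, 0 ≤ C ∧ ∀ (k : ℕ) (v : m → ℝ), ‖(M ^ k).mulVec v‖ ≤ C * r ^ k * ‖v‖ := by
  have hr0 : 0 < r := (specRad_nonneg M).trans_lt hr
  set Mc := M.map ((↑) : ℝ → ℂ) with hMc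
  have hlt : spectralRadius ℂ Mc < ENNReal.ofReal r := by
    rw [← ENNReal.ofReal_toReal (spectralRadius_complexMatrix_ne_top Mc)]
    exact (ENNReal.ofReal_lt_ofReal_iff hr0).2 hr
  have hev := (spectrum.pow_norm_pow_one_div_tendsto_nhds_spectralRadius Mc).eventually_lt_const hlt
  obtain ⟨K, hK⟩ := eventually_atTop.1 (hev.and (eventually_ge_atTop 1))
  have hbig : ∀ k ≥ K, ‖Mc ^ k‖ ≤ r ^ k := by
    intro k hk
    obtain ⟨h1, h2⟩ := hK k hk
    have h3 := ((ENNReal.ofReal_lt_ofReal_iff hr0).1 h1).le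
    have hk0 : k ≠ 0 := by omega
    calc ‖Mc ^ k‖ = (‖Mc ^ k‖ ^ (1 / k : ℝ)) ^ k := by
          rw [one_div, Real.rpow_inv_natCast_pow (norm_nonneg _) hk0]
      _ ≤ r ^ k := by gcongr
  -- the finitely many small powers are absorbed into the constant
  refine ⟨1 + ∑ k ∈ Finset.range K, ‖Mc ^ k‖ / r ^ k, by positivity, fun k v => ?_⟩
  have hall : ‖Mc ^ k‖ ≤ (1 + ∑ k ∈ Finset.range K, ‖Mc ^ k‖ / r ^ k) * r ^ k := by
    rcases le_or_gt K k with h | h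
    · calc ‖Mc ^ k‖ ≤ 1 * r ^ k := by simpa using hbig k h
        _ ≤ _ := by
          gcongr
          exact le_add_of_nonneg_right (by positivity)
    · rw [← div_le_iff₀ (by positivity)]
      have := Finset.single_le_sum (f := fun k => ‖Mc ^ k‖ / r ^ k)
        (fun i _ => by positivity) (Finset.mem_range.2 h)
      linarith
  have hmap : (fun i => (((M ^ k).mulVec v i : ℝ) : ℂ)) = (Mc ^ k).mulVec (fun i => (v i : ℂ)) := by
    have : Mc ^ k = (M ^ k).map ((↑) : ℝ → ℂ) := (Matrix.map_pow M Complex.ofRealHom k).symm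
    rw [this]
    ext i
    simp [Matrix.mulVec, dotProduct]
  have hn : ∀ w : m → ℝ, ‖(fun i => (w i : ℂ))‖ = ‖w‖ := fun w => by
    simp only [Pi.norm_def, Complex.nnnorm_real]
  calc ‖(M ^ k).mulVec v‖ = ‖(Mc ^ k).mulVec (fun i => (v i : ℂ))‖ := by rw [← hmap, hn]
    _ ≤ ‖Mc ^ k‖ * ‖(fun i => (v i : ℂ))‖ := Matrix.linfty_opNorm_mulVec _ _
    _ ≤ _ := by rw [hn]; gcongr

end Norms

theorem pow_mulVec_tendsto_zero {M : Matrix m m ℝ} (hM : specRad M < 1) (v : m → ℝ) :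
    Tendsto (fun k : ℕ => (M ^ k).mulVec v) atTop (𝓝 0) := by
  obtain ⟨r, hr, hr1⟩ := exists_between hM
  obtain ⟨C, -, hC⟩ := exists_norm_pow_mulVec_le M hr
  refine squeeze_zero_norm (hC · v) ?_
  have := tendsto_pow_atTop_nhds_zero_of_lt_one ((specRad_nonneg M).trans hr.le) hr1
  simpa using (this.const_mul C).mul_const ‖v‖

/-- The converse of `pow_mulVec_tendsto_zero`. -/
theorem specRad_lt_one_of_pow_mulVec_tendsto_zero {M : Matrix m m ℝ}
    (h : ∀ v, Tendsto (fun k : ℕ => (M ^ k).mulVec v) atTop (𝓝 0)) : specRad M < 1 := by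
  refine specRad_lt one_pos fun l hl => ?_
  obtain ⟨v, hv, hlv⟩ := (mem_spectrum_iff_exists_mulVec_eq_smul _ _).1 hl
  have hpow : ∀ k : ℕ, ((M.map ((↑) : ℝ → ℂ)) ^ k).mulVec v = l ^ k • v := by
    intro k
    induction k with
    | zero => simp
    | succ k ih => rw [pow_succ, ← Matrix.mulVec_mulVec, hlv, Matrix.mulVec_smul, ih, smul_smul,
        pow_succ']
  obtain ⟨i, hi⟩ := Function.ne_iff.1 hv
  -- the real and imaginary parts of the eigenvector are real vectors
  have hcoord : ∀ k : ℕ, l ^ k * v i =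
      (((M ^ k).mulVec (fun j => (v j).re) i : ℝ) : ℂ) +
        (((M ^ k).mulVec (fun j => (v j).im) i : ℝ) : ℂ) * Complex.I := by
    intro k
    have h1 := congrFun (hpow k) i
    have h2 : (M.map ((↑) : ℝ → ℂ)) ^ k = (M ^ k).map ((↑) : ℝ → ℂ) :=
      (Matrix.map_pow M Complex.ofRealHom k).symm
    rw [h2] at h1
    simp only [Matrix.mulVec, dotProduct, Matrix.map_apply, Pi.smul_apply, smul_eq_mul] at h1 ⊢
    rw [← h1]
    push_cast
    rw [Finset.sum_mul, ← Finset.sum_add_distrib]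
    refine Finset.sum_congr rfl fun j _ => ?_
    conv_lhs => rw [← Complex.re_add_im (v j)]
    ring
  have ht : Tendsto (fun k : ℕ => l ^ k * v i) atTop (𝓝 0) := by
    simp_rw [hcoord]
    have h1 := ((continuous_apply i).tendsto _).comp (h fun j => (v j).re)
    have h2 := ((continuous_apply i).tendsto _).comp (h fun j => (v j).im)
    have h3 := (Complex.continuous_ofReal.tendsto _).comp h1
    have h4 := ((Complex.continuous_ofReal.tendsto _).comp h2).mul_const Complex.I
    simpa using h3.add h4
  have ht' : Tendsto (fun k : ℕ => l ^ k) atTop (𝓝 0) := by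
    have := ht.mul_const (v i)⁻¹
    simpa [mul_assoc, mul_inv_cancel₀ (show v i ≠ 0 from hi)] using this
  exact tendsto_pow_atTop_nhds_zero_iff_norm_lt_one.1 ht'

theorem isUnit_one_sub_of_specRad_lt_one {M : Matrix m m ℝ} (hM : specRad M < 1) :
    IsUnit (1 - M) := by
  rw [Matrix.isUnit_iff_isUnit_det, isUnit_iff_ne_zero]
  intro hdet
  obtain ⟨v, hv, h⟩ := Matrix.exists_mulVec_eq_zero_iff.2 hdet
  rw [Matrix.sub_mulVec, Matrix.one_mulVec, sub_eq_zero] at h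
  have hpow : ∀ k : ℕ, (M ^ k).mulVec v = v := by
    intro k
    induction k with
    | zero => simp
    | succ k ih => rw [pow_succ, ← Matrix.mulVec_mulVec, ← h, ih]
  have := pow_mulVec_tendsto_zero hM v
  simp only [hpow] at this
  exact hv (tendsto_nhds_unique tendsto_const_nhds this)

/-- The eigenvalues of a block triangular matrix are those of its diagonal blocks. -/
theorem spectrum_fromBlocks_zero₁₂ {m' : Type*} [Fintype m'] [DecidableEq m'] {K : Type*} [Field K]
    (A : Matrix m m K) (C : Matrix m' m K) (D : Matrix m' m' K) :
    spectrum K (Matrix.fromBlocks A 0 C D) = spectrum K A ∪ spectrum K D := by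
  ext l
  simp only [Set.mem_union, Matrix.mem_spectrum_iff_isRoot_charpoly,
    Matrix.charpoly_fromBlocks_zero₁₂, Polynomial.root_mul]

theorem linearRecursion_eq {M : Matrix m m ℝ} {e u : ℕ → m → ℝ}
    (he : ∀ k, e (k + 1) = M.mulVec (e k) + u k) (k : ℕ) :
    e k = (M ^ k).mulVec (e 0) + ∑ j ∈ Finset.range k, (M ^ (k - 1 - j)).mulVec (u j) := by
  induction k with
  | zero => simp
  | succ k ih =>
    rw [he, ih, Matrix.mulVec_add, Matrix.mulVec_mulVec, ← pow_succ', Finset.sum_range_succ,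
      Matrix.mulVec_sum, add_assoc]
    congr 1
    simp only [add_tsub_cancel_right, tsub_self, pow_zero, Matrix.one_mulVec]
    congr 1
    refine Finset.sum_congr rfl fun j hj => ?_
    rw [Matrix.mulVec_mulVec, ← pow_succ']
    have := Finset.mem_range.1 hj
    congr 2
    omega

/-- For a recursion `e ↦ M e + u` whose forcing decays like `s ^ k` with `s > σ(M)`, the error decays
at the same rate; no power of `k` is lost because `s` is strictly larger than `σ(M)`. -/
theorem linearRecursion_norm_le {M : Matrix m m ℝ} {s : ℝ} (hs : specRad M < s) {e u : ℕ → m → ℝ}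
    (he : ∀ k, e (k + 1) = M.mulVec (e k) + u k) {c : ℝ} (hu : ∀ k, ‖u k‖ ≤ c * s ^ k) :
    ∃ C : ℝ, 0 ≤ C ∧ ∀ k, ‖e k‖ ≤ C * s ^ k := by
  obtain ⟨r, hr, hrs⟩ := exists_between hs
  have hr0 : 0 < r := (specRad_nonneg M).trans_lt hr
  have hs0 : 0 < s := hr0.trans hrs
  have hc : 0 ≤ c := by simpa using (norm_nonneg _).trans (hu 0)
  obtain ⟨C, hC, hM⟩ := exists_norm_pow_mulVec_le M hr
  -- `∑ r ^ (k-1-j) s ^ j ≤ s ^ k / (s - r)`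
  have hgeom : ∀ k, ∑ j ∈ Finset.range k, r ^ (k - 1 - j) * s ^ j ≤ s ^ k / (s - r) := by
    intro k
    rw [le_div_iff₀ (sub_pos.2 hrs)]
    have := Commute.geom_sum₂_mul (Commute.all s r) k
    simp_rw [mul_comm (r ^ _)]
    rw [this]
    linarith [pow_nonneg hr0.le k]
  refine ⟨C * ‖e 0‖ + C * c / (s - r), ?_, fun k => ?_⟩
  · have := sub_pos.2 hrs
    positivity
  calc ‖e k‖ ≤ ‖(M ^ k).mulVec (e 0)‖ +
        ∑ j ∈ Finset.range k, ‖(M ^ (k - 1 - j)).mulVec (u j)‖ := by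
        rw [linearRecursion_eq he k]
        exact (norm_add_le _ _).trans (by gcongr; exact norm_sum_le _ _)
    _ ≤ C * s ^ k * ‖e 0‖ + ∑ j ∈ Finset.range k, C * c * (r ^ (k - 1 - j) * s ^ j) := by
        gcongr with j hj
        · exact (hM k _).trans (by gcongr)
        · calc _ ≤ C * r ^ (k - 1 - j) * ‖u j‖ := hM _ _
            _ ≤ C * r ^ (k - 1 - j) * (c * s ^ j) := by gcongr; exact hu j
            _ = _ := by ring
    _ ≤ C * s ^ k * ‖e 0‖ + C * c * (s ^ k / (s - r)) := by
        rw [← Finset.mul_sum]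
        gcongr
        exact hgeom k
    _ = _ := by ring

/-- A stable linear recursion with vanishing forcing tends to zero. -/
theorem linearRecursion_tendsto_zero {M : Matrix m m ℝ} (hM : specRad M < 1) {e u : ℕ → m → ℝ}
    (he : ∀ k, e (k + 1) = M.mulVec (e k) + u k) (hu : Tendsto u atTop (𝓝 0)) :
    Tendsto e atTop (𝓝 0) := by
  obtain ⟨r, hr, hr1⟩ := exists_between hM
  have hr0 : 0 < r := (specRad_nonneg M).trans_lt hr
  obtain ⟨C, hC, hpow⟩ := exists_norm_pow_mulVec_le M hr
  obtain ⟨B, hB⟩ := hu.norm.bddAbove_range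
  have hB' : ∀ j, ‖u j‖ ≤ B := fun j => hB ⟨j, rfl⟩
  have hB0 : 0 ≤ B := (norm_nonneg _).trans (hB' 0)
  -- dominated convergence for the convolution of `r ^ i` with the forcing
  have hconv : Tendsto (fun k : ℕ => ∑' i, if i < k then r ^ i * ‖u (k - 1 - i)‖ else 0)
      atTop (𝓝 (∑' _ : ℕ, (0 : ℝ))) := by
    refine tendsto_tsum_of_dominated_convergence (bound := fun i => r ^ i * B)
      ((summable_geometric_of_lt_one hr0.le hr1).mul_right B) (fun i => ?_)
      (Eventually.of_forall fun k i => ?_)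
    · have h1 : Tendsto (fun k : ℕ => k - 1 - i) atTop atTop :=
        (tendsto_sub_atTop_nat i).comp (tendsto_sub_atTop_nat 1)
      have h2 := ((hu.comp h1).norm).const_mul (r ^ i)
      rw [norm_zero, mul_zero] at h2
      refine h2.congr' ?_
      filter_upwards [eventually_gt_atTop i] with k hk
      simp [hk]
    · split_ifs
      · rw [Real.norm_of_nonneg (by positivity)]
        gcongr
        exact hB' _
      · simpa using by positivity
  rw [tsum_zero] at hconv
  have hpow0 : Tendsto (fun k : ℕ => C * r ^ k * ‖e 0‖) atTop (𝓝 0) := by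
    simpa using ((tendsto_pow_atTop_nhds_zero_of_lt_one hr0.le hr1).const_mul C).mul_const ‖e 0‖
  refine squeeze_zero_norm (fun k => ?_) (by simpa using hpow0.add (hconv.const_mul C))
  have htsum : (∑' i, if i < k then r ^ i * ‖u (k - 1 - i)‖ else 0) =
      ∑ j ∈ Finset.range k, r ^ (k - 1 - j) * ‖u j‖ := by
    rw [tsum_eq_sum (s := Finset.range k) (by intro i hi; simp_all),
      ← Finset.sum_range_reflect (fun j => r ^ (k - 1 - j) * ‖u j‖)]
    refine Finset.sum_congr rfl fun i hi => ?_
    have := Finset.mem_range.1 hi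
    rw [if_pos this]
    congr 2
    omega
  calc ‖e k‖ ≤ ‖(M ^ k).mulVec (e 0)‖ +
        ∑ j ∈ Finset.range k, ‖(M ^ (k - 1 - j)).mulVec (u j)‖ := by
        rw [linearRecursion_eq he k]
        exact (norm_add_le _ _).trans (by gcongr; exact norm_sum_le _ _)
    _ ≤ C * r ^ k * ‖e 0‖ + ∑ j ∈ Finset.range k, C * (r ^ (k - 1 - j) * ‖u j‖) := by
        gcongr with j hj
        · exact hpow k _
        · exact (hpow _ _).trans (by rw [mul_assoc])
    _ = _ := by rw [htsum, Finset.mul_sum]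

end SpectralRadius

/-! ### Mean-square stability implies mean stability -/

section MeanSquare

variable {N : Type*} [Fintype N] {d : ℕ}

theorem kronecker_one_mulVec_apply {m R : Type*} [Fintype m] [DecidableEq m] [CommSemiring R]
    (B : Matrix N N R) (v : N × m → R) (j : N) (x : m) :
    (B ⊗ₖ (1 : Matrix m m R)).mulVec v (j, x) = ∑ i, B j i * v (i, x) := by
  simp [Matrix.mulVec, dotProduct, Fintype.sum_prod_type, Matrix.one_apply]

theorem H21_mulVec_apply (P : Matrix N N ℝ) (A : N → Matrix (Fin d) (Fin d) ℝ) (b : N → Fin d → ℝ)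
    (α : ℝ) (v : N × Fin d → ℝ) (j : N) (a c : Fin d) :
    (H21 P A b α).mulVec v (j, (a, c)) =
      ∑ i, P i j * (α * (b i a * ∑ f, Hi A α i c f * v (i, f)) +
        α * (b i c * ∑ e, Hi A α i a e * v (i, e))) := by
  simp only [Matrix.mulVec, dotProduct, Fintype.sum_prod_type, H21, Matrix.of_apply, Sblock,
    Matrix.add_apply, colKron, kronCol]
  refine Finset.sum_congr rfl fun i _ => ?_
  simp only [Finset.mul_sum, ← Finset.sum_add_distrib]
  refine Finset.sum_congr rfl fun e _ => ?_
  ring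

/-- The quadratic form of the block at `i` of a stacked vector of matrices. -/
def blockQuad (Q : N × (Fin d × Fin d) → ℝ) (i : N) (v : Fin d → ℝ) : ℝ :=
  ∑ a, ∑ c, v a * v c * Q (i, (a, c))

variable [DecidableEq N]

theorem blockDiag_mulVec_apply {m : Type*} [Fintype m] (G : N → Matrix m m ℝ) (v : N × m → ℝ)
    (i : N) (x : m) : (blockDiag G).mulVec v (i, x) = ∑ y, G i x y * v (i, y) := by
  simp only [Matrix.mulVec, dotProduct, Fintype.sum_prod_type, blockDiag, Matrix.of_apply]
  rw [Finset.sum_eq_single i]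
  · simp
  · intro b _ hb
    simp [Ne.symm hb]
  · simp

theorem H11_mulVec_apply (P : Matrix N N ℝ) (A : N → Matrix (Fin d) (Fin d) ℝ) (α : ℝ)
    (v : N × Fin d → ℝ) (j : N) (a : Fin d) :
    (H11 P A α).mulVec v (j, a) = ∑ i, P i j * ∑ c, Hi A α i a c * v (i, c) := by
  rw [H11, ← Matrix.mulVec_mulVec, kronecker_one_mulVec_apply]
  simp only [blockDiag_mulVec_apply, Matrix.transpose_apply]

theorem H22_mulVec_apply (P : Matrix N N ℝ) (A : N → Matrix (Fin d) (Fin d) ℝ) (α : ℝ)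
    (v : N × (Fin d × Fin d) → ℝ) (j : N) (a c : Fin d) :
    (H22 P A α).mulVec v (j, (a, c)) =
      ∑ i, P i j * ∑ e, ∑ f, Hi A α i a e * Hi A α i c f * v (i, (e, f)) := by
  rw [H22, ← Matrix.mulVec_mulVec, kronecker_one_mulVec_apply]
  simp only [blockDiag_mulVec_apply, Matrix.transpose_apply, Fintype.sum_prod_type,
    Matrix.kroneckerMap_apply]

theorem blockQuad_H22_mulVec (P : Matrix N N ℝ) (A : N → Matrix (Fin d) (Fin d) ℝ) (α : ℝ)
    (Q : N × (Fin d × Fin d) → ℝ) (j : N) (v : Fin d → ℝ) :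
    blockQuad ((H22 P A α).mulVec Q) j v =
      ∑ i, P i j * blockQuad Q i (Matrix.vecMul v (Hi A α i)) := by
  have h : ∀ i, blockQuad Q i (Matrix.vecMul v (Hi A α i)) =
      ∑ a, ∑ c, v a * v c * ∑ e, ∑ f, Hi A α i a e * Hi A α i c f * Q (i, (e, f)) := by
    intro i
    calc _ = ∑ a, ∑ c, ∑ e, ∑ f, v e * v f *
          (Hi A α i e a * Hi A α i f c * Q (i, (a, c))) := by
          simp only [blockQuad, Matrix.vecMul, dotProduct]
          refine Finset.sum_congr rfl fun a _ => Finset.sum_congr rfl fun c _ => ?_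
          rw [Finset.sum_mul_sum, Finset.sum_mul]
          refine Finset.sum_congr rfl fun e _ => ?_
          rw [Finset.sum_mul]
          refine Finset.sum_congr rfl fun f _ => ?_
          ring
      _ = ∑ x : (Fin d × Fin d), ∑ y : (Fin d × Fin d), v y.1 * v y.2 *
          (Hi A α i y.1 x.1 * Hi A α i y.2 x.2 * Q (i, (x.1, x.2))) := by
          simp only [Fintype.sum_prod_type]
      _ = _ := by
          rw [Finset.sum_comm]
          simp only [Fintype.sum_prod_type, Finset.mul_sum]
  simp only [h]
  simp only [blockQuad, H22_mulVec_apply, Finset.mul_sum (s := (Finset.univ : Finset N))]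
  rw [Finset.sum_congr rfl fun a _ => Finset.sum_comm, Finset.sum_comm]
  refine Finset.sum_congr rfl fun i _ => ?_
  rw [Finset.mul_sum]
  refine Finset.sum_congr rfl fun a _ => ?_
  rw [Finset.mul_sum]
  refine Finset.sum_congr rfl fun c _ => ?_
  ring

theorem dotProduct_H11_mulVec (P : Matrix N N ℝ) (A : N → Matrix (Fin d) (Fin d) ℝ) (α : ℝ)
    (q : N × Fin d → ℝ) (j : N) (v : Fin d → ℝ) :
    ∑ a, v a * (H11 P A α).mulVec q (j, a) =
      ∑ i, P i j * ∑ a, Matrix.vecMul v (Hi A α i) a * q (i, a) := by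
  simp only [H11_mulVec_apply, Matrix.vecMul, dotProduct, Finset.mul_sum, Finset.sum_mul]
  rw [Finset.sum_comm]
  refine Finset.sum_congr rfl fun i _ => ?_
  rw [Finset.sum_comm]
  refine Finset.sum_congr rfl fun a _ => Finset.sum_congr rfl fun c _ => ?_
  ring

/-- Cauchy–Schwarz for the jump system: the first moments are dominated by the second moments,
weighted by the (unnormalized) mass `(Pᵀ) ^ k 1` of the modes. -/
theorem sq_H11_pow_le_blockQuad {P : Matrix N N ℝ} (hP : P ∈ Matrix.rowStochastic ℝ N)
    (A : N → Matrix (Fin d) (Fin d) ℝ) (α : ℝ) (q : N × Fin d → ℝ) (k : ℕ) :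
    ∀ j, 0 ≤ ((P.transpose) ^ k).mulVec 1 j ∧ ∀ v,
      0 ≤ blockQuad (((H22 P A α) ^ k).mulVec fun x => q (x.1, x.2.1) * q (x.1, x.2.2)) j v ∧
      (∑ a, v a * ((H11 P A α) ^ k).mulVec q (j, a)) ^ 2 ≤ ((P.transpose) ^ k).mulVec 1 j *
        blockQuad (((H22 P A α) ^ k).mulVec fun x => q (x.1, x.2.1) * q (x.1, x.2.2)) j v := by
  have hPn : ∀ i j, 0 ≤ P i j := fun i j => hP.1 i j
  induction k with
  | zero =>
    intro j
    refine ⟨by simp, fun v => ?_⟩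
    have h : blockQuad (((H22 P A α) ^ 0).mulVec fun x => q (x.1, x.2.1) * q (x.1, x.2.2)) j v =
        (∑ a, v a * q (j, a)) ^ 2 := by
      rw [sq, Finset.sum_mul_sum]
      simp only [blockQuad, pow_zero, Matrix.one_mulVec]
      exact Finset.sum_congr rfl fun a _ => Finset.sum_congr rfl fun c _ => by ring
    rw [h]
    exact ⟨sq_nonneg _, by simp⟩
  | succ k ih =>
    intro j
    have hw : ((P.transpose) ^ (k + 1)).mulVec 1 j =
        ∑ i, P i j * ((P.transpose) ^ k).mulVec 1 i := by
      rw [pow_succ', ← Matrix.mulVec_mulVec]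
      rfl
    refine ⟨hw ▸ Finset.sum_nonneg fun i _ => mul_nonneg (hPn _ _) (ih i).1, fun v => ?_⟩
    rw [hw, pow_succ' (H22 P A α), ← Matrix.mulVec_mulVec, blockQuad_H22_mulVec,
      pow_succ' (H11 P A α), ← Matrix.mulVec_mulVec, dotProduct_H11_mulVec]
    refine ⟨Finset.sum_nonneg fun i _ => mul_nonneg (hPn _ _) ((ih i).2 _).1, ?_⟩
    refine Finset.sum_sq_le_sum_mul_sum_of_sq_le_mul _
      (fun i _ => mul_nonneg (hPn _ _) (ih i).1)
      (fun i _ => mul_nonneg (hPn _ _) ((ih i).2 _).1) fun i _ => ?_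
    calc _ = P i j ^ 2 * (∑ a, Matrix.vecMul v (Hi A α i) a * ((H11 P A α) ^ k).mulVec q (i, a)) ^ 2
          := by ring
      _ ≤ P i j ^ 2 * (((P.transpose) ^ k).mulVec 1 i * blockQuad
          (((H22 P A α) ^ k).mulVec fun x => q (x.1, x.2.1) * q (x.1, x.2.2)) i
          (Matrix.vecMul v (Hi A α i))) := by
          gcongr
          exact ((ih i).2 _).2
      _ = _ := by ring

theorem transpose_pow_mulVec_one_le {P : Matrix N N ℝ} (hP : P ∈ Matrix.rowStochastic ℝ N) (k : ℕ)
    (j : N) : ((P.transpose) ^ k).mulVec 1 j ≤ Fintype.card N := by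
  have hk : P ^ k ∈ Matrix.rowStochastic ℝ N := pow_mem hP k
  rw [← Matrix.transpose_pow]
  calc (P ^ k).transpose.mulVec 1 j = ∑ i, (P ^ k) i j := by simp [Matrix.mulVec, dotProduct]
    _ ≤ ∑ _i : N, (1 : ℝ) := by
        refine Finset.sum_le_sum fun i _ => ?_
        exact Matrix.le_one_of_mem_rowStochastic hk
    _ = _ := by simp

/-- Mean-square stability implies mean stability. -/
theorem specRad_H11_lt_one {P : Matrix N N ℝ} (hP : P ∈ Matrix.rowStochastic ℝ N)
    (A : N → Matrix (Fin d) (Fin d) ℝ) {α : ℝ} (h : specRad (H22 P A α) < 1) :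
    specRad (H11 P A α) < 1 := by
  refine specRad_lt_one_of_pow_mulVec_tendsto_zero fun q => tendsto_pi_nhds.2 fun ⟨j, a⟩ => ?_
  set Q : N × (Fin d × Fin d) → ℝ := fun x => q (x.1, x.2.1) * q (x.1, x.2.2) with hQ
  have hb : ∀ k, blockQuad (((H22 P A α) ^ k).mulVec Q) j (Pi.single a 1) =
      ((H22 P A α) ^ k).mulVec Q (j, (a, a)) := fun k => by
    simp [blockQuad, Pi.single_apply]
  have ht : Tendsto (fun k => (Fintype.card N : ℝ) * ((H22 P A α) ^ k).mulVec Q (j, (a, a)))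
      atTop (𝓝 0) := by
    simpa using ((tendsto_pi_nhds.1 (pow_mulVec_tendsto_zero h Q)) (j, (a, a))).const_mul
      (Fintype.card N : ℝ)
  have hsq : Tendsto (fun k => (((H11 P A α) ^ k).mulVec q (j, a)) ^ 2) atTop (𝓝 0) := by
    refine squeeze_zero (fun _ => sq_nonneg _) (fun k => ?_) ht
    obtain ⟨-, h2⟩ := sq_H11_pow_le_blockQuad hP A α q k j
    obtain ⟨h3, h4⟩ := h2 (Pi.single a 1)
    have h5 : ∑ c, (Pi.single a 1 : Fin d → ℝ) c * ((H11 P A α) ^ k).mulVec q (j, c) =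
        ((H11 P A α) ^ k).mulVec q (j, a) := by simp [Pi.single_apply]
    rw [h5] at h4
    rw [← hb]
    exact h4.trans (mul_le_mul_of_nonneg_right (transpose_pow_mulVec_one_le hP k j) h3)
  have := hsq.sqrt
  simp only [Real.sqrt_sq_eq_abs, Real.sqrt_zero] at this
  exact (tendsto_zero_iff_abs_tendsto_zero _).2 this

theorem specRad_Hfull_lt {P : Matrix N N ℝ} {A : N → Matrix (Fin d) (Fin d) ℝ}
    {b : N → Fin d → ℝ} {α r : ℝ} (hr : 0 < r)
    (h1 : ∀ l ∈ spectrum ℂ ((H11 P A α).map ((↑) : ℝ → ℂ)), ‖l‖ < r)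
    (h2 : ∀ l ∈ spectrum ℂ ((H22 P A α).map ((↑) : ℝ → ℂ)), ‖l‖ < r) :
    specRad (Hfull P A b α) < r := by
  refine specRad_lt hr fun l hl => ?_
  rw [Hfull, Matrix.fromBlocks_map, Matrix.map_zero _ (by simp), spectrum_fromBlocks_zero₁₂] at hl
  exact hl.elim (h1 l) (h2 l)

theorem specRad_Hfull_lt_one {P : Matrix N N ℝ} (hP : P ∈ Matrix.rowStochastic ℝ N)
    (A : N → Matrix (Fin d) (Fin d) ℝ) (b : N → Fin d → ℝ) {α : ℝ} (h : specRad (H22 P A α) < 1) :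
    specRad (Hfull P A b α) < 1 :=
  specRad_Hfull_lt one_pos (fun _ hl => (norm_le_specRad hl).trans_lt (specRad_H11_lt_one hP A h))
    (fun _ hl => (norm_le_specRad hl).trans_lt h)

theorem norm_le_specRad_Hfull {P : Matrix N N ℝ} {A : N → Matrix (Fin d) (Fin d) ℝ}
    {b : N → Fin d → ℝ} {α : ℝ} {l : ℂ}
    (hl : l ∈ spectrum ℂ ((H11 P A α).map ((↑) : ℝ → ℂ))) : ‖l‖ ≤ specRad (Hfull P A b α) := by
  refine norm_le_specRad ?_
  rw [Hfull, Matrix.fromBlocks_map, Matrix.map_zero _ (by simp), spectrum_fromBlocks_zero₁₂]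
  exact Or.inl hl

end MeanSquare

/-! ### Moment recursions along the Markov chain -/

section Moments

theorem apply_mode_eq_sum_indicator {Ω N E : Type*} [Fintype N] [AddCommMonoid E] (f : N → Ω → E) (ζ : Ω → N) :
    (fun ω => f (ζ ω) ω) = fun ω => ∑ i, (ζ ⁻¹' {i}).indicator (f i) ω := by
  classical
  ext ω
  simp [Set.indicator_apply]

variable {Ω N S : Type*} {d : ℕ}

theorem tdIter_error_succ_apply (φ : S → EuclideanSpace ℝ (Fin d)) (r : S → ℝ) (γ : ℝ)
    (θstar : EuclideanSpace ℝ (Fin d)) {cur nxt : N → S} {s : ℕ → Ω → S} {z : ℕ → Ω → N}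
    (hs : ∀ k ω, s k ω = cur (z k ω) ∧ s (k + 1) ω = nxt (z k ω))
    (θ₀ : Ω → EuclideanSpace ℝ (Fin d)) (α : ℝ) (k : ℕ) (ω : Ω) (a : Fin d) :
    (tdIter φ r γ s θ₀ α (k + 1) ω - θstar) a =
      ∑ c, Hi (tdA φ γ cur nxt) α (z k ω) a c * (tdIter φ r γ s θ₀ α k ω - θstar) c +
        α * tdb φ r γ θstar cur nxt (z k ω) a := by
  obtain ⟨h1, h2⟩ := hs k ω
  have h3 : ∑ c, Hi (tdA φ γ cur nxt) α (z k ω) a c * (tdIter φ r γ s θ₀ α k ω - θstar) c =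
      (tdIter φ r γ s θ₀ α k ω - θstar) a + α * (φ (cur (z k ω)) a *
        inner ℝ (γ • φ (nxt (z k ω)) - φ (cur (z k ω))) (tdIter φ r γ s θ₀ α k ω - θstar)) := by
    simp only [Hi, Matrix.add_apply, Matrix.smul_apply, smul_eq_mul, add_mul,
      Finset.sum_add_distrib, tdA, Matrix.of_apply, Matrix.one_apply, ite_mul, one_mul, zero_mul,
      Finset.sum_ite_eq, Finset.mem_univ, if_true, PiLp.inner_apply, Finset.mul_sum]
    congr 1
    refine Finset.sum_congr rfl fun c _ => ?_
    simp
    ring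
  rw [h3, tdIter]
  beta_reduce
  rw [h1, h2, inner_sub_right]
  simp only [PiLp.sub_apply, PiLp.smul_apply, smul_eq_mul, tdb, inner_sub_left]
  ring

variable [mΩ : MeasurableSpace Ω] {μ : Measure Ω} {ℱ : Filtration ℕ mΩ} {P : Matrix N N ℝ} {z : ℕ → Ω → N}

variable {A : N → Matrix (Fin d) (Fin d) ℝ} {b : N → Fin d → ℝ} {α : ℝ}
  {ξ : ℕ → Ω → EuclideanSpace ℝ (Fin d)}

variable [Fintype N]

/-- The mean square error is the total trace of the mode-wise second moments. -/
theorem integral_norm_sq_eq (hz : IsMarkovChain μ ℱ P z) {k : ℕ}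
    (h : ∀ a, StronglyMeasurable[ℱ k] (fun ω => ξ k ω a) ∧ MemLp (fun ω => ξ k ω a) 2 μ) :
    ∫ ω, ‖ξ k ω‖ ^ 2 ∂μ =
      (fun x : N × (Fin d × Fin d) => (1 : ℝ) * Matrix.vec (1 : Matrix (Fin d) (Fin d) ℝ) x.2) ⬝ᵥ
        vecQ μ z ξ k := by
  have hi : ∀ i, MeasurableSet (z k ⁻¹' {i}) := fun i => ℱ.le _ _ (hz.adapted _ _)
  have hint : ∀ e, Integrable (fun ω => ξ k ω e * ξ k ω e) μ :=
    fun e => (h e).2.integrable_mul (h e).2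
  have h1 : (fun ω => ‖ξ k ω‖ ^ 2) = fun ω => ∑ i, (z k ⁻¹' {i}).indicator
      (fun ω => ∑ a, ξ k ω a * ξ k ω a) ω := by
    rw [← apply_mode_eq_sum_indicator (fun _ ω => ∑ a, ξ k ω a * ξ k ω a) (z k)]
    ext ω
    rw [EuclideanSpace.real_norm_sq_eq]
    simp only [sq]
  have h2 : ∀ i, ∫ ω, (z k ⁻¹' {i}).indicator (fun ω => ∑ a, ξ k ω a * ξ k ω a) ω ∂μ =
      ∑ a, ∫ ω, (z k ⁻¹' {i}).indicator (fun ω => ξ k ω a * ξ k ω a) ω ∂μ := fun i => by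
    simp only [integral_indicator (hi i)]
    exact integral_finsetSum _ fun a _ => (hint a).integrableOn
  rw [h1, integral_finsetSum _ fun i _ =>
    (integrable_finsetSum _ fun a _ => hint a).indicator (hi i)]
  simp only [h2, dotProduct, Fintype.sum_prod_type, vecQ, Matrix.vec, Qmat, Matrix.of_apply,
    one_mul, Matrix.one_apply, ite_mul, zero_mul, Finset.sum_ite_eq',
    Finset.mem_univ, if_true]

variable [IsProbabilityMeasure μ]

/-- The Markov property, integrated against a variable known at time `k`. -/
theorem IsMarkovChain.setIntegral_succ (hz : IsMarkovChain μ ℱ P z) {k : ℕ} {X : Ω → ℝ}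
    (hX : StronglyMeasurable[ℱ k] X) (hX' : Integrable X μ) (j : N) :
    ∫ ω, (z (k + 1) ⁻¹' {j}).indicator X ω ∂μ =
      ∑ i, P i j * ∫ ω, (z k ⁻¹' {i}).indicator X ω ∂μ := by
  have hj : MeasurableSet (z (k + 1) ⁻¹' {j}) := ℱ.le _ _ (hz.adapted _ _)
  have hi : ∀ i, MeasurableSet (z k ⁻¹' {i}) := fun i => ℱ.le _ _ (hz.adapted _ _)
  set I : Ω → ℝ := (z (k + 1) ⁻¹' {j}).indicator fun _ => (1 : ℝ) with hI
  have hIX : X * I = (z (k + 1) ⁻¹' {j}).indicator X := by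
    ext ω
    by_cases h : ω ∈ z (k + 1) ⁻¹' {j} <;> simp [hI, h]
  have hpull : μ[X * I | ℱ k] =ᵐ[μ] X * μ[I | ℱ k] :=
    condExp_mul_of_stronglyMeasurable_left hX (hIX ▸ hX'.indicator hj)
      ((integrable_const _).indicator hj)
  have hsum : (fun ω => X ω * P (z k ω) j) =
      fun ω => ∑ i, (z k ⁻¹' {i}).indicator (fun ω => P i j * X ω) ω := by
    rw [← apply_mode_eq_sum_indicator (fun i ω => P i j * X ω) (z k)]
    ext ω
    exact mul_comm _ _
  calc ∫ ω, (z (k + 1) ⁻¹' {j}).indicator X ω ∂μ = ∫ ω, (X * I) ω ∂μ := by rw [hIX]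
    _ = ∫ ω, (μ[X * I | ℱ k]) ω ∂μ := (integral_condExp (ℱ.le k)).symm
    _ = ∫ ω, X ω * P (z k ω) j ∂μ := by
        refine integral_congr_ae ?_
        filter_upwards [hpull, hz.transition k j] with ω h1 h2
        rw [h1, Pi.mul_apply, h2]
    _ = ∑ i, ∫ ω, (z k ⁻¹' {i}).indicator (fun ω => P i j * X ω) ω ∂μ := by
        rw [hsum]
        exact integral_finsetSum _ fun i _ => (hX'.const_mul _).indicator (hi i)
    _ = _ := by
        refine Finset.sum_congr rfl fun i _ => ?_
        rw [integral_indicator (hi i), integral_indicator (hi i), integral_const_mul]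

/-- Square-integrability and adaptedness propagate along the jump recursion. In fact `ξ (k + 1)` is
already known at time `k`, since it depends on `z k` only. -/
theorem stronglyMeasurable_succ_of_step (hz : IsMarkovChain μ ℱ P z)
    (hξ : ∀ k ω a, ξ (k + 1) ω a = ∑ c, Hi A α (z k ω) a c * ξ k ω c + α * b (z k ω) a) {k : ℕ}
    (h : ∀ a, StronglyMeasurable[ℱ k] (fun ω => ξ k ω a) ∧ MemLp (fun ω => ξ k ω a) 2 μ)
    (a : Fin d) :
    StronglyMeasurable[ℱ k] (fun ω => ξ (k + 1) ω a) ∧ MemLp (fun ω => ξ (k + 1) ω a) 2 μ := by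
  have heq : (fun ω => ξ (k + 1) ω a) = fun ω => ∑ i, (z k ⁻¹' {i}).indicator
      (fun ω => ∑ c, Hi A α i a c * ξ k ω c + α * b i a) ω := by
    rw [← apply_mode_eq_sum_indicator
      (fun i ω => ∑ c, Hi A α i a c * ξ k ω c + α * b i a) (z k)]
    ext ω
    exact hξ k ω a
  rw [heq]
  constructor
  · refine Finset.stronglyMeasurable_fun_sum _ fun i _ => ?_
    refine StronglyMeasurable.indicator ?_ (hz.adapted k i)
    exact (Finset.stronglyMeasurable_fun_sum _ fun c _ =>
      (h c).1.const_mul _).add stronglyMeasurable_const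
  · refine memLp_finsetSum _ fun i _ => ?_
    refine MemLp.indicator (ℱ.le _ _ (hz.adapted k i)) ?_
    exact (memLp_finsetSum _ fun c _ => (h c).2.const_mul _).add (memLp_const _)

theorem stronglyMeasurable_of_step (hz : IsMarkovChain μ ℱ P z)
    (hξ : ∀ k ω a, ξ (k + 1) ω a = ∑ c, Hi A α (z k ω) a c * ξ k ω c + α * b (z k ω) a)
    (h0 : ∀ a, StronglyMeasurable[ℱ 0] (fun ω => ξ 0 ω a) ∧ MemLp (fun ω => ξ 0 ω a) 2 μ) (k : ℕ) :
    ∀ a, StronglyMeasurable[ℱ k] (fun ω => ξ k ω a) ∧ MemLp (fun ω => ξ k ω a) 2 μ := by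
  induction k with
  | zero => exact h0
  | succ k ih =>
    intro a
    obtain ⟨h1, h2⟩ := stronglyMeasurable_succ_of_step hz hξ ih a
    exact ⟨h1.mono (ℱ.mono k.le_succ), h2⟩

variable [DecidableEq N]

theorem qVec_succ (hz : IsMarkovChain μ ℱ P z)
    (hξ : ∀ k ω a, ξ (k + 1) ω a = ∑ c, Hi A α (z k ω) a c * ξ k ω c + α * b (z k ω) a) {k : ℕ}
    (h : ∀ a, StronglyMeasurable[ℱ k] (fun ω => ξ k ω a) ∧ MemLp (fun ω => ξ k ω a) 2 μ) :
    qVec μ z ξ (k + 1) = (H11 P A α).mulVec (qVec μ z ξ k) +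
      α • ((P.transpose * Matrix.diagonal (law μ z k)) ⊗ₖ
        (1 : Matrix (Fin d) (Fin d) ℝ)).mulVec (bStack b) := by
  have hi : ∀ i, MeasurableSet (z k ⁻¹' {i}) := fun i => ℱ.le _ _ (hz.adapted _ _)
  ext ⟨j, a⟩
  obtain ⟨h1, h2⟩ := stronglyMeasurable_succ_of_step hz hξ h a
  have hint : ∀ c, Integrable (fun ω => ξ k ω c) μ := fun c => (h c).2.integrable one_le_two
  simp only [Pi.add_apply, Pi.smul_apply, smul_eq_mul, H11_mulVec_apply,
    kronecker_one_mulVec_apply, Matrix.mul_diagonal, Matrix.transpose_apply, bStack]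
  change ∫ ω, (z (k + 1) ⁻¹' {j}).indicator (fun ω => ξ (k + 1) ω a) ω ∂μ = _
  rw [hz.setIntegral_succ h1 (h2.integrable one_le_two), Finset.mul_sum, ← Finset.sum_add_distrib]
  refine Finset.sum_congr rfl fun i _ => ?_
  have hcongr : (z k ⁻¹' {i}).indicator (fun ω => ξ (k + 1) ω a) =
      (z k ⁻¹' {i}).indicator (fun ω => ∑ c, Hi A α i a c * ξ k ω c + α * b i a) := by
    refine Set.indicator_congr fun ω hω => ?_
    rw [hξ, show z k ω = i from hω]
  rw [hcongr, integral_indicator (hi i), integral_add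
    (integrable_finsetSum _ fun c _ => ((hint c).const_mul _).integrableOn)
    (integrable_const _), integral_finsetSum _ fun c _ => ((hint c).const_mul _).integrableOn]
  simp only [integral_const_mul, integral_const, smul_eq_mul, measureReal_restrict_apply_univ,
    qVec, law, integral_indicator (hi i)]
  ring

theorem vecQ_succ (hz : IsMarkovChain μ ℱ P z)
    (hξ : ∀ k ω a, ξ (k + 1) ω a = ∑ c, Hi A α (z k ω) a c * ξ k ω c + α * b (z k ω) a) {k : ℕ}
    (h : ∀ a, StronglyMeasurable[ℱ k] (fun ω => ξ k ω a) ∧ MemLp (fun ω => ξ k ω a) 2 μ) :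
    vecQ μ z ξ (k + 1) = (H21 P A b α).mulVec (qVec μ z ξ k) + (H22 P A α).mulVec (vecQ μ z ξ k) +
      α ^ 2 • ((P.transpose * Matrix.diagonal (law μ z k)) ⊗ₖ
        (1 : Matrix (Fin d × Fin d) (Fin d × Fin d) ℝ)).mulVec (bbStack b) := by
  have hi : ∀ i, MeasurableSet (z k ⁻¹' {i}) := fun i => ℱ.le _ _ (hz.adapted _ _)
  ext ⟨j, a, c⟩
  obtain ⟨ha1, ha2⟩ := stronglyMeasurable_succ_of_step hz hξ h a
  obtain ⟨hc1, hc2⟩ := stronglyMeasurable_succ_of_step hz hξ h c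
  have hint : ∀ c, Integrable (fun ω => ξ k ω c) μ := fun c => (h c).2.integrable one_le_two
  have hint2 : ∀ e f, Integrable (fun ω => ξ k ω e * ξ k ω f) μ :=
    fun e f => (h e).2.integrable_mul (h f).2
  simp only [Pi.add_apply, Pi.smul_apply, smul_eq_mul, H22_mulVec_apply, H21_mulVec_apply,
    kronecker_one_mulVec_apply, Matrix.mul_diagonal, Matrix.transpose_apply, bbStack]
  change ∫ ω, (z (k + 1) ⁻¹' {j}).indicator
    ((fun ω => ξ (k + 1) ω c) * (fun ω => ξ (k + 1) ω a)) ω ∂μ = _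
  rw [hz.setIntegral_succ (hc1.mul ha1) (hc2.integrable_mul ha2), Finset.mul_sum,
    ← Finset.sum_add_distrib, ← Finset.sum_add_distrib]
  refine Finset.sum_congr rfl fun i _ => ?_
  have hcongr : (z k ⁻¹' {i}).indicator ((fun ω => ξ (k + 1) ω c) * (fun ω => ξ (k + 1) ω a)) =
      (z k ⁻¹' {i}).indicator (fun ω => (∑ e, ∑ f, Hi A α i a e * Hi A α i c f *
        (ξ k ω f * ξ k ω e)) + (∑ f, α * b i a * Hi A α i c f * ξ k ω f) +
        (∑ e, α * b i c * Hi A α i a e * ξ k ω e) + α ^ 2 * (b i a * b i c)) := by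
    refine Set.indicator_congr fun ω hω => ?_
    rw [Pi.mul_apply, hξ, hξ, show z k ω = i from hω]
    have e1 : (∑ e, ∑ f, Hi A α i a e * Hi A α i c f * (ξ k ω f * ξ k ω e)) =
        (∑ e, Hi A α i a e * ξ k ω e) * (∑ f, Hi A α i c f * ξ k ω f) := by
      rw [Finset.sum_mul_sum]
      exact Finset.sum_congr rfl fun _ _ => Finset.sum_congr rfl fun _ _ => by ring
    rw [e1]
    simp only [mul_assoc, ← Finset.mul_sum]
    ring
  have i1 : IntegrableOn (fun ω => ∑ e, ∑ f, Hi A α i a e * Hi A α i c f *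
      (ξ k ω f * ξ k ω e)) (z k ⁻¹' {i}) μ :=
    (integrable_finsetSum _ fun e _ => integrable_finsetSum _ fun f _ =>
      (hint2 f e).const_mul _).integrableOn
  have i2 : ∀ g : Fin d → ℝ, IntegrableOn (fun ω => ∑ f, g f * ξ k ω f) (z k ⁻¹' {i}) μ :=
    fun g => (integrable_finsetSum _ fun e _ => (hint e).const_mul _).integrableOn
  have i2' : ∀ g : Fin d → ℝ, ∫ ω in z k ⁻¹' {i}, ∑ f, g f * ξ k ω f ∂μ =
      ∑ f, g f * ∫ ω in z k ⁻¹' {i}, ξ k ω f ∂μ := fun g => by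
    rw [integral_finsetSum _ fun c _ => ((hint c).const_mul _).integrableOn]
    simp only [integral_const_mul]
  have i1' : ∫ ω in z k ⁻¹' {i}, ∑ e, ∑ f, Hi A α i a e * Hi A α i c f *
      (ξ k ω f * ξ k ω e) ∂μ = ∑ e, ∑ f, Hi A α i a e * Hi A α i c f *
      ∫ ω in z k ⁻¹' {i}, ξ k ω f * ξ k ω e ∂μ := by
    rw [integral_finsetSum _ fun e _ => (integrable_finsetSum _ fun f _ =>
      (hint2 f e).const_mul _).integrableOn]
    refine Finset.sum_congr rfl fun e _ => ?_
    rw [integral_finsetSum _ fun f _ => ((hint2 f e).const_mul _).integrableOn]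
    simp only [integral_const_mul]
  have hsplit : ∀ {f g h : Ω → ℝ} (c : ℝ), IntegrableOn f (z k ⁻¹' {i}) μ →
      IntegrableOn g (z k ⁻¹' {i}) μ → IntegrableOn h (z k ⁻¹' {i}) μ →
      ∫ ω in z k ⁻¹' {i}, f ω + g ω + h ω + c ∂μ = (∫ ω in z k ⁻¹' {i}, f ω ∂μ) +
        (∫ ω in z k ⁻¹' {i}, g ω ∂μ) + (∫ ω in z k ⁻¹' {i}, h ω ∂μ) + μ.real (z k ⁻¹' {i}) * c := by
    intro f g h c hf hg hh
    rw [integral_add (f := fun ω => f ω + g ω + h ω) ((hf.add hg).add hh) (integrable_const _),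
      integral_add (f := fun ω => f ω + g ω) (hf.add hg) hh, integral_add hf hg]
    simp
  rw [hcongr, integral_indicator (hi i), hsplit _ i1 (i2 _) (i2 _), i1', i2', i2']
  simp only [qVec, vecQ, Qmat, Matrix.vec, Matrix.of_apply, law, integral_indicator (hi i), mul_assoc,
    ← Finset.mul_sum]
  ring

end Moments

/-! ### Limits and rates for a fixed learning rate -/

section FixedLearningRate

variable {N : Type*} [Fintype N] [DecidableEq N] {d : ℕ}

theorem qInf_eq (P : Matrix N N ℝ) (A : N → Matrix (Fin d) (Fin d) ℝ) (b : N → Fin d → ℝ)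
    (π : N → ℝ) {α : ℝ} (h : IsUnit (1 - H11 P A α)) :
    qInf P A b π α = (H11 P A α).mulVec (qInf P A b π α) +
      α • ((P.transpose * Matrix.diagonal π) ⊗ₖ
        (1 : Matrix (Fin d) (Fin d) ℝ)).mulVec (bStack b) := by
  have h1 : (1 - H11 P A α).mulVec (qInf P A b π α) =
      α • ((P.transpose * Matrix.diagonal π) ⊗ₖ
        (1 : Matrix (Fin d) (Fin d) ℝ)).mulVec (bStack b) := by
    rw [qInf, Matrix.mulVec_smul, Matrix.mulVec_mulVec,
      Matrix.mul_nonsing_inv _ ((Matrix.isUnit_iff_isUnit_det _).1 h), Matrix.one_mulVec]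
  rw [← h1, Matrix.sub_mulVec, Matrix.one_mulVec, add_sub_cancel]

theorem vecQInf_eq (P : Matrix N N ℝ) (A : N → Matrix (Fin d) (Fin d) ℝ) (b : N → Fin d → ℝ)
    (π : N → ℝ) {α : ℝ} (hα : α ≠ 0) (h : IsUnit (1 - H22 P A α)) :
    vecQInf P A b π α = (H21 P A b α).mulVec (qInf P A b π α) +
      (H22 P A α).mulVec (vecQInf P A b π α) +
      α ^ 2 • ((P.transpose * Matrix.diagonal π) ⊗ₖ
        (1 : Matrix (Fin d × Fin d) (Fin d × Fin d) ℝ)).mulVec (bbStack b) := by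
  have h1 : (1 - H22 P A α).mulVec (vecQInf P A b π α) =
      (H21 P A b α).mulVec (qInf P A b π α) +
      α ^ 2 • ((P.transpose * Matrix.diagonal π) ⊗ₖ
        (1 : Matrix (Fin d × Fin d) (Fin d × Fin d) ℝ)).mulVec (bbStack b) := by
    rw [vecQInf, Matrix.mulVec_smul, Matrix.mulVec_mulVec,
      Matrix.mul_nonsing_inv _ ((Matrix.isUnit_iff_isUnit_det _).1 h), Matrix.one_mulVec,
      smul_add, smul_smul, mul_inv_cancel₀ (pow_ne_zero 2 hα), one_smul]
  rw [Matrix.sub_mulVec, Matrix.one_mulVec, sub_eq_iff_eq_add] at h1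
  rw [add_right_comm, ← h1]

/-- The inhomogeneous term of the moment recursion when the modes have law `p`; it is linear in `p`. -/
noncomputable def forcing (P : Matrix N N ℝ) (b : N → Fin d → ℝ) (α : ℝ) :
    (N → ℝ) →ₗ[ℝ] ((N × Fin d) ⊕ (N × (Fin d × Fin d)) → ℝ) where
  toFun p := Sum.elim
    (α • ((P.transpose * Matrix.diagonal p) ⊗ₖ
      (1 : Matrix (Fin d) (Fin d) ℝ)).mulVec (bStack b))
    (α ^ 2 • ((P.transpose * Matrix.diagonal p) ⊗ₖ
      (1 : Matrix (Fin d × Fin d) (Fin d × Fin d) ℝ)).mulVec (bbStack b))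
  map_add' p q := by
    ext (⟨j, x⟩ | ⟨j, x⟩) <;>
    simp only [Sum.elim_inl, Sum.elim_inr, Pi.add_apply, Pi.smul_apply, kronecker_one_mulVec_apply,
      Matrix.mul_diagonal, mul_add, add_mul, Finset.sum_add_distrib, smul_eq_mul]
  map_smul' c p := by
    ext (⟨j, x⟩ | ⟨j, x⟩) <;>
    simp only [Sum.elim_inl, Sum.elim_inr, Pi.smul_apply, kronecker_one_mulVec_apply,
      Matrix.mul_diagonal, smul_eq_mul, RingHom.id_apply, Finset.mul_sum] <;>
    exact Finset.sum_congr rfl fun i _ => by ring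

variable {Ω : Type*} [mΩ : MeasurableSpace Ω] {μ : Measure Ω} {ℱ : Filtration ℕ mΩ}
  {P : Matrix N N ℝ} {z : ℕ → Ω → N}
  {A : N → Matrix (Fin d) (Fin d) ℝ} {b : N → Fin d → ℝ} {α : ℝ} {π : N → ℝ}
  {ξ : ℕ → Ω → EuclideanSpace ℝ (Fin d)}

/-- The deviation of the first and second moments at time `k` from their stationary values. -/
noncomputable def momentError (μ : Measure Ω) (P : Matrix N N ℝ) (z : ℕ → Ω → N)
    (A : N → Matrix (Fin d) (Fin d) ℝ) (b : N → Fin d → ℝ) (α : ℝ) (π : N → ℝ)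
    (ξ : ℕ → Ω → EuclideanSpace ℝ (Fin d)) (k : ℕ) :
    (N × Fin d) ⊕ (N × (Fin d × Fin d)) → ℝ :=
  Sum.elim (qVec μ z ξ k) (vecQ μ z ξ k) - Sum.elim (qInf P A b π α) (vecQInf P A b π α)

variable [IsProbabilityMeasure μ]

theorem momentError_succ (hz : IsMarkovChain μ ℱ P z)
    (hξ : ∀ k ω a, ξ (k + 1) ω a = ∑ c, Hi A α (z k ω) a c * ξ k ω c + α * b (z k ω) a)
    (h0 : ∀ a, StronglyMeasurable[ℱ 0] (fun ω => ξ 0 ω a) ∧ MemLp (fun ω => ξ 0 ω a) 2 μ)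
    (hα : α ≠ 0) (h1 : IsUnit (1 - H11 P A α)) (h2 : IsUnit (1 - H22 P A α)) (k : ℕ) :
    momentError μ P z A b α π ξ (k + 1) =
      (Hfull P A b α).mulVec (momentError μ P z A b α π ξ k) +
        forcing P b α (law μ z k - π) := by
  have hk := stronglyMeasurable_of_step hz hξ h0 k
  have e1 : Sum.elim (qVec μ z ξ (k + 1)) (vecQ μ z ξ (k + 1)) =
      (Hfull P A b α).mulVec (Sum.elim (qVec μ z ξ k) (vecQ μ z ξ k)) +
        forcing P b α (law μ z k) := by
    rw [qVec_succ hz hξ hk, vecQ_succ hz hξ hk, Hfull, Matrix.fromBlocks_mulVec]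
    ext (x | x) <;> simp [forcing]
  have e2 : Sum.elim (qInf P A b π α) (vecQInf P A b π α) =
      (Hfull P A b α).mulVec (Sum.elim (qInf P A b π α) (vecQInf P A b π α)) +
        forcing P b α π := by
    rw [Hfull, Matrix.fromBlocks_mulVec]
    ext (x | x)
    · simpa [forcing] using congrFun (qInf_eq P A b π h1) x
    · simpa [forcing] using congrFun (vecQInf_eq P A b π hα h2) x
  unfold momentError
  rw [Matrix.mulVec_sub, map_sub, e1]
  nth_rewrite 1 [e2]
  abel

theorem momentError_tendsto_zero (hz : IsMarkovChain μ ℱ P z)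
    (hξ : ∀ k ω a, ξ (k + 1) ω a = ∑ c, Hi A α (z k ω) a c * ξ k ω c + α * b (z k ω) a)
    (h0 : ∀ a, StronglyMeasurable[ℱ 0] (fun ω => ξ 0 ω a) ∧ MemLp (fun ω => ξ 0 ω a) 2 μ)
    (hα : α ≠ 0) (hP : P ∈ Matrix.rowStochastic ℝ N) (hσ : specRad (H22 P A α) < 1)
    (hp : Tendsto (law μ z) atTop (𝓝 π)) :
    Tendsto (momentError μ P z A b α π ξ) atTop (𝓝 0) := by
  refine linearRecursion_tendsto_zero (specRad_Hfull_lt_one hP A b hσ)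
    (momentError_succ hz hξ h0 hα (isUnit_one_sub_of_specRad_lt_one (specRad_H11_lt_one hP A hσ))
      (isUnit_one_sub_of_specRad_lt_one hσ)) ?_
  have := ((forcing P b α).continuous_of_finiteDimensional.tendsto 0).comp
    (show Tendsto (fun k => law μ z k - π) atTop (𝓝 0) by simpa using hp.sub_const π)
  rw [map_zero] at this
  exact this

theorem momentError_norm_le (hz : IsMarkovChain μ ℱ P z)
    (hξ : ∀ k ω a, ξ (k + 1) ω a = ∑ c, Hi A α (z k ω) a c * ξ k ω c + α * b (z k ω) a)
    (h0 : ∀ a, StronglyMeasurable[ℱ 0] (fun ω => ξ 0 ω a) ∧ MemLp (fun ω => ξ 0 ω a) 2 μ)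
    (hα : α ≠ 0) (hP : P ∈ Matrix.rowStochastic ℝ N) (hσ : specRad (H22 P A α) < 1)
    {C ρ : ℝ} (hC : ∀ k, ‖law μ z k - π‖ ≤ C * ρ ^ k) {ε : ℝ} (hε : 0 < ε) :
    ∃ C₀ : ℝ, 0 ≤ C₀ ∧ ∀ k, ‖momentError μ P z A b α π ξ k‖ ≤
      C₀ * max (specRad (Hfull P A b α) + ε) ρ ^ k := by
  set s := max (specRad (Hfull P A b α) + ε) ρ with hs
  have hσs : specRad (Hfull P A b α) < s := (lt_add_of_pos_right _ hε).trans_le (le_max_left _ _)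
  have hC0 : 0 ≤ C := by simpa using (norm_nonneg _).trans (hC 0)
  have hs0 : 0 ≤ s := (specRad_nonneg _).trans hσs.le
  -- a negative `ρ` forces `C ρ = 0`, hence `C ρ ^ k = 0` for `k ≥ 1`
  have hlaw : ∀ k, ‖law μ z k - π‖ ≤ C * s ^ k := by
    intro k
    rcases le_or_gt 0 ρ with hρ | hρ
    · exact (hC k).trans (by gcongr; exact le_max_right _ _)
    · have h1 : 0 ≤ C * ρ := by simpa using (norm_nonneg _).trans (hC 1)
      have h2 : C = 0 := le_antisymm (nonpos_of_mul_nonneg_left h1 hρ) hC0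
      simpa [h2] using hC k
  set T := LinearMap.toContinuousLinearMap (forcing P b α) with hT
  refine linearRecursion_norm_le hσs (c := ‖T‖ * C)
    (momentError_succ hz hξ h0 hα (isUnit_one_sub_of_specRad_lt_one (specRad_H11_lt_one hP A hσ))
      (isUnit_one_sub_of_specRad_lt_one hσ)) fun k => ?_
  calc ‖forcing P b α (law μ z k - π)‖ ≤ ‖T‖ * ‖law μ z k - π‖ := T.le_opNorm _
    _ ≤ ‖T‖ * (C * s ^ k) := by gcongr; exact hlaw k
    _ = _ := by ring

theorem integral_norm_sq_sub_deltaInf (hz : IsMarkovChain μ ℱ P z)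
    (hξ : ∀ k ω a, ξ (k + 1) ω a = ∑ c, Hi A α (z k ω) a c * ξ k ω c + α * b (z k ω) a)
    (h0 : ∀ a, StronglyMeasurable[ℱ 0] (fun ω => ξ 0 ω a) ∧ MemLp (fun ω => ξ 0 ω a) 2 μ) (k : ℕ) :
    ∫ ω, ‖ξ k ω‖ ^ 2 ∂μ - deltaInf P A b π α =
      (fun x : N × (Fin d × Fin d) => (1 : ℝ) * Matrix.vec (1 : Matrix (Fin d) (Fin d) ℝ) x.2) ⬝ᵥ
        fun x => momentError μ P z A b α π ξ k (Sum.inr x) := by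
  rw [integral_norm_sq_eq hz (stronglyMeasurable_of_step hz hξ h0 k), deltaInf, ← dotProduct_sub]
  rfl

theorem moments_tendsto (hz : IsMarkovChain μ ℱ P z)
    (hξ : ∀ k ω a, ξ (k + 1) ω a = ∑ c, Hi A α (z k ω) a c * ξ k ω c + α * b (z k ω) a)
    (h0 : ∀ a, StronglyMeasurable[ℱ 0] (fun ω => ξ 0 ω a) ∧ MemLp (fun ω => ξ 0 ω a) 2 μ)
    (hα : α ≠ 0) (hP : P ∈ Matrix.rowStochastic ℝ N) (hσ : specRad (H22 P A α) < 1)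
    (hp : Tendsto (law μ z) atTop (𝓝 π)) :
    Tendsto (qVec μ z ξ) atTop (𝓝 (qInf P A b π α)) ∧
      Tendsto (vecQ μ z ξ) atTop (𝓝 (vecQInf P A b π α)) ∧
      Tendsto (fun k => ∫ ω, ‖ξ k ω‖ ^ 2 ∂μ) atTop (𝓝 (deltaInf P A b π α)) := by
  have h := tendsto_pi_nhds.1 (momentError_tendsto_zero (b := b) hz hξ h0 hα hP hσ hp)
  refine ⟨tendsto_pi_nhds.2 fun x => ?_, tendsto_pi_nhds.2 fun x => ?_, ?_⟩
  · simpa [momentError] using (h (Sum.inl x)).add_const (qInf P A b π α x)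
  · simpa [momentError] using (h (Sum.inr x)).add_const (vecQInf P A b π α x)
  · refine tendsto_sub_nhds_zero_iff.1 ?_
    simp only [integral_norm_sq_sub_deltaInf hz hξ h0]
    unfold dotProduct
    have := tendsto_finsetSum (Finset.univ : Finset (N × (Fin d × Fin d))) fun x _ =>
      (h (Sum.inr x)).const_mul (1 * Matrix.vec (1 : Matrix (Fin d) (Fin d) ℝ) x.2)
    simpa using this

theorem abs_integral_norm_sq_sub_deltaInf_le (hz : IsMarkovChain μ ℱ P z)
    (hξ : ∀ k ω a, ξ (k + 1) ω a = ∑ c, Hi A α (z k ω) a c * ξ k ω c + α * b (z k ω) a)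
    (h0 : ∀ a, StronglyMeasurable[ℱ 0] (fun ω => ξ 0 ω a) ∧ MemLp (fun ω => ξ 0 ω a) 2 μ)
    (hα : α ≠ 0) (hP : P ∈ Matrix.rowStochastic ℝ N) (hσ : specRad (H22 P A α) < 1)
    {C ρ : ℝ} (hC : ∀ k, ‖law μ z k - π‖ ≤ C * ρ ^ k) {ε : ℝ} (hε : 0 < ε) :
    ∃ C₀ : ℝ, ∀ k, |∫ ω, ‖ξ k ω‖ ^ 2 ∂μ - deltaInf P A b π α| ≤
      C₀ * max (specRad (Hfull P A b α) + ε) ρ ^ k := by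
  obtain ⟨C₀, hC₀, h⟩ := momentError_norm_le (b := b) hz hξ h0 hα hP hσ hC hε
  set w : N × (Fin d × Fin d) → ℝ := fun x => 1 * Matrix.vec (1 : Matrix (Fin d) (Fin d) ℝ) x.2
  refine ⟨(∑ x, |w x|) * C₀, fun k => ?_⟩
  rw [integral_norm_sq_sub_deltaInf hz hξ h0]
  calc _ ≤ ∑ x, |w x * momentError μ P z A b α π ξ k (Sum.inr x)| :=
        Finset.abs_sum_le_sum_abs _ _
    _ ≤ ∑ x, |w x| * ‖momentError μ P z A b α π ξ k‖ := by
        refine Finset.sum_le_sum fun x _ => ?_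
        rw [abs_mul]
        gcongr
        exact norm_le_pi_norm (momentError μ P z A b α π ξ k) (Sum.inr x)
    _ = (∑ x, |w x|) * ‖momentError μ P z A b α π ξ k‖ := by rw [Finset.sum_mul]
    _ ≤ _ := by
        rw [mul_assoc]
        gcongr
        exact h k

end FixedLearningRate

/-! ### Perturbation of a dominant semisimple eigenvalue -/

section Perturbation

variable {W m : Type*} [Fintype W] [DecidableEq W] [Fintype m]

/-- The perturbed matrix `K + t (E₀ + t E₁)`. -/
def perturbed {𝕜 : Type*} [NormedField 𝕜] (K E₀ E₁ : Matrix W W 𝕜) (t : 𝕜) : Matrix W W 𝕜 :=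
  K + t • (E₀ + t • E₁)

/-- The pencil `(1 + t ζ) - (K + t (E₀ + t E₁))` after its component along the fixed vectors of `K`
has been divided by `t`; unlike the original pencil, it is regular at `t = 0`. -/
def rescaledPencil {𝕜 : Type*} [NormedField 𝕜] (K E₀ E₁ : Matrix W W 𝕜) (L : Matrix m W 𝕜)
    (X : Matrix W m 𝕜) (t ζ : 𝕜) : Matrix W W 𝕜 :=
  (1 - K) + t • ((1 - X * L) * (ζ • 1 - (E₀ + t • E₁))) + X * L * (ζ • 1 - (E₀ + t • E₁))

theorem continuous_rescaledPencil {𝕜 : Type*} [NormedField 𝕜] (K E₀ E₁ : Matrix W W 𝕜) (L : Matrix m W 𝕜) (X : Matrix W m 𝕜) :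
    Continuous fun p : 𝕜 × 𝕜 => rescaledPencil K E₀ E₁ L X p.1 p.2 := by
  unfold rescaledPencil
  fun_prop

theorem differentiable_det_rescaledPencil (K E₀ E₁ : Matrix W W ℂ) (L : Matrix m W ℂ)
    (X : Matrix W m ℂ) (t : ℂ) :
    Differentiable ℂ fun ζ => (rescaledPencil K E₀ E₁ L X t ζ).det := by
  simp only [Matrix.det_apply]
  have hent : ∀ i j, Differentiable ℂ fun ζ => rescaledPencil K E₀ E₁ L X t ζ i j := by
    intro i j
    simp only [rescaledPencil, Matrix.add_apply, Matrix.smul_apply, Matrix.mul_apply (N := _ - _),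
      Matrix.sub_apply]
    fun_prop
  fun_prop

variable [DecidableEq m]

/-- `1` is a semisimple eigenvalue of `K` that dominates all others: the powers of `K` converge to the
projection `X L` onto the fixed vectors, `L` and `X` being dual bases of the left and the right fixed
vectors. -/
structure IsDominantSplitting {𝕜 : Type*} [NormedField 𝕜] (K : Matrix W W 𝕜) (L : Matrix m W 𝕜)
    (X : Matrix W m 𝕜) : Prop where
  left_mul : L * K = L
  mul_right : K * X = X
  left_mul_right : L * X = 1
  tendsto_pow : Tendsto (fun k : ℕ => K ^ k) atTop (𝓝 (X * L))

section Field

variable {𝕜 : Type*} [NormedField 𝕜] {K E₀ E₁ : Matrix W W 𝕜} {L : Matrix m W 𝕜}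
  {X : Matrix W m 𝕜}

theorem IsDominantSplitting.proj_mul (h : IsDominantSplitting K L X) :
    X * L * (1 - K) = 0 := by
  rw [Matrix.mul_sub, Matrix.mul_one, Matrix.mul_assoc, h.left_mul, sub_self]

theorem IsDominantSplitting.proj_mul_proj (h : IsDominantSplitting K L X) :
    X * L * (X * L) = X * L := by
  rw [Matrix.mul_assoc, ← Matrix.mul_assoc L, h.left_mul_right, Matrix.one_mul]

theorem IsDominantSplitting.rescale_mul (h : IsDominantSplitting K L X) {t : 𝕜} (ht : t ≠ 0)
    (ζ : 𝕜) :
    (1 - X * L + t⁻¹ • (X * L)) * ((1 + t * ζ) • 1 - perturbed K E₀ E₁ t) =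
      rescaledPencil K E₀ E₁ L X t ζ := by
  have h1 : (1 + t * ζ) • (1 : Matrix W W 𝕜) - perturbed K E₀ E₁ t =
      (1 - K) + t • (ζ • 1 - (E₀ + t • E₁)) := by
    rw [perturbed, add_smul, one_smul, mul_smul, smul_sub]
    abel
  rw [h1, rescaledPencil, Matrix.add_mul, Matrix.mul_add, Matrix.sub_mul, h.proj_mul,
    Matrix.smul_mul, Matrix.mul_add, h.proj_mul, Matrix.mul_smul, Matrix.mul_smul, zero_add,
    smul_smul, inv_mul_cancel₀ ht, one_smul, sub_zero, Matrix.one_mul]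

theorem IsDominantSplitting.isUnit_rescale (h : IsDominantSplitting K L X) {t : 𝕜} (ht : t ≠ 0) :
    IsUnit (1 - X * L + t⁻¹ • (X * L)) := by
  refine IsUnit.of_mul_eq_one (1 - X * L + t • (X * L)) ?_
  have e := h.proj_mul_proj
  simp only [Matrix.add_mul, Matrix.mul_add, Matrix.sub_mul, Matrix.mul_sub, Matrix.one_mul,
    Matrix.mul_one, Matrix.smul_mul, Matrix.mul_smul, e, sub_self, zero_add]
  rw [smul_smul, mul_inv_cancel₀ ht, one_smul]
  abel

theorem IsDominantSplitting.mem_spectrum_perturbed_iff (h : IsDominantSplitting K L X) {t : 𝕜}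
    (ht : t ≠ 0) (ζ : 𝕜) :
    1 + t * ζ ∈ spectrum 𝕜 (perturbed K E₀ E₁ t) ↔
      (rescaledPencil K E₀ E₁ L X t ζ).det = 0 := by
  rw [spectrum.mem_iff, Algebra.algebraMap_eq_smul_one, Matrix.isUnit_iff_isUnit_det,
    isUnit_iff_ne_zero, not_not, ← h.rescale_mul ht, Matrix.det_mul, mul_eq_zero]
  have := (Matrix.isUnit_iff_isUnit_det _).1 (h.isUnit_rescale ht)
  exact ⟨Or.inr, fun h' => h'.resolve_left this.ne_zero⟩

theorem IsDominantSplitting.eq_of_mulVec_eq (h : IsDominantSplitting K L X) {v : W → 𝕜}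
    (hv : K.mulVec v = v) : X.mulVec (L.mulVec v) = v := by
  have hpow : ∀ k : ℕ, (K ^ k).mulVec v = v := fun k => by
    induction k with
    | zero => simp
    | succ k ih => rw [pow_succ, ← Matrix.mulVec_mulVec, hv, ih]
  have ht : Tendsto (fun k : ℕ => (K ^ k).mulVec v) atTop (𝓝 ((X * L).mulVec v)) :=
    ((continuous_id.matrix_mulVec continuous_const).tendsto _).comp h.tendsto_pow
  simp only [hpow] at ht
  rw [Matrix.mulVec_mulVec]
  exact (tendsto_nhds_unique tendsto_const_nhds ht).symm

/-- The eigenvalues of `K` other than `1` lie strictly inside the unit disc. -/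
theorem IsDominantSplitting.eq_one_of_mulVec_eq_smul (h : IsDominantSplitting K L X) {v : W → 𝕜}
    (hv0 : v ≠ 0) {l : 𝕜} (hv : K.mulVec v = l • v) (hl : 1 ≤ ‖l‖) : l = 1 := by
  have hpow : ∀ k : ℕ, (K ^ k).mulVec v = l ^ k • v := fun k => by
    induction k with
    | zero => simp
    | succ k ih => rw [pow_succ, ← Matrix.mulVec_mulVec, hv, Matrix.mulVec_smul, ih, smul_smul,
        pow_succ']
  have ht : Tendsto (fun k : ℕ => (K ^ k).mulVec v) atTop (𝓝 ((X * L).mulVec v)) :=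
    ((continuous_id.matrix_mulVec continuous_const).tendsto _).comp h.tendsto_pow
  simp only [hpow] at ht
  obtain ⟨i, hi⟩ := Function.ne_iff.1 hv0
  have hti : Tendsto (fun k : ℕ => l ^ k * v i) atTop (𝓝 ((X * L).mulVec v i)) :=
    tendsto_pi_nhds.1 ht i
  have hti' : Tendsto (fun k : ℕ => l ^ (k + 1) * v i) atTop (𝓝 ((X * L).mulVec v i)) :=
    (tendsto_add_atTop_iff_nat 1).2 hti
  have hl' : Tendsto (fun k : ℕ => l ^ (k + 1) * v i) atTop (𝓝 (l * (X * L).mulVec v i)) := by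
    refine (hti.const_mul l).congr fun k => ?_
    ring
  have heq := tendsto_nhds_unique hl' hti'
  have hne : (X * L).mulVec v i ≠ 0 := by
    have h1 : ‖v i‖ ≤ ‖(X * L).mulVec v i‖ := by
      refine ge_of_tendsto' hti.norm fun k => ?_
      rw [norm_mul, norm_pow]
      exact le_mul_of_one_le_left (norm_nonneg _) (one_le_pow₀ hl)
    exact norm_pos_iff.1 ((norm_pos_iff.2 hi).trans_le h1)
  exact mul_right_cancel₀ hne (by rw [heq, one_mul])

/-- At `t = 0` the rescaled pencil is singular exactly at the eigenvalues of the compression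
`L E₀ X`. -/
theorem IsDominantSplitting.det_rescaledPencil_zero_eq_zero_iff (h : IsDominantSplitting K L X)
    (ζ : 𝕜) :
    (rescaledPencil K E₀ E₁ L X 0 ζ).det = 0 ↔ ζ ∈ spectrum 𝕜 (L * E₀ * X) := by
  have h0 : rescaledPencil K E₀ E₁ L X 0 ζ = (1 - K) + X * L * (ζ • 1 - E₀) := by
    simp [rescaledPencil]
  have hL : L * (1 - K) = 0 := by rw [Matrix.mul_sub, Matrix.mul_one, h.left_mul, sub_self]
  rw [h0, mem_spectrum_iff_exists_mulVec_eq_smul, ← Matrix.exists_mulVec_eq_zero_iff]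
  constructor
  · rintro ⟨v, hv0, hv⟩
    have h1 : L.mulVec ((ζ • 1 - E₀).mulVec v) = 0 := by
      have h2 := congrArg (L.mulVec ·) hv
      simp only [Matrix.mulVec_mulVec, Matrix.mul_add, hL, zero_add, Matrix.mulVec_zero] at h2
      rw [← Matrix.mul_assoc, ← Matrix.mul_assoc, h.left_mul_right, Matrix.one_mul] at h2
      rw [Matrix.mulVec_mulVec, h2]
    have h3 : K.mulVec v = v := by
      rw [Matrix.add_mulVec, Matrix.mul_assoc, ← Matrix.mulVec_mulVec, ← Matrix.mulVec_mulVec, h1,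
        Matrix.mulVec_zero, add_zero, Matrix.sub_mulVec, Matrix.one_mulVec, sub_eq_zero] at hv
      exact hv.symm
    have h4 := h.eq_of_mulVec_eq h3
    refine ⟨L.mulVec v, fun h5 => hv0 ?_, ?_⟩
    · rw [← h4, h5, Matrix.mulVec_zero]
    · rw [← Matrix.mulVec_mulVec, h4, ← Matrix.mulVec_mulVec]
      rw [Matrix.sub_mulVec, Matrix.smul_mulVec, Matrix.one_mulVec, Matrix.mulVec_sub,
        Matrix.mulVec_smul, sub_eq_zero] at h1
      exact h1.symm
  · rintro ⟨w, hw0, hw⟩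
    refine ⟨X.mulVec w, fun h1 => hw0 ?_, ?_⟩
    · have := congrArg (L.mulVec ·) h1
      simpa [Matrix.mulVec_mulVec, h.left_mul_right] using this
    · have h1 : (1 - K).mulVec (X.mulVec w) = 0 := by
        rw [Matrix.mulVec_mulVec, Matrix.sub_mul, Matrix.one_mul, h.mul_right, sub_self,
          Matrix.zero_mulVec]
      have h2 : L.mulVec (X.mulVec w) = w := by
        rw [Matrix.mulVec_mulVec, h.left_mul_right, Matrix.one_mulVec]
      have h3 : L.mulVec (E₀.mulVec (X.mulVec w)) = ζ • w := by
        rw [← hw, Matrix.mulVec_mulVec, Matrix.mulVec_mulVec, Matrix.mul_assoc]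
      rw [Matrix.add_mulVec, h1, zero_add, ← Matrix.mulVec_mulVec, ← Matrix.mulVec_mulVec,
        Matrix.sub_mulVec, Matrix.smul_mulVec, Matrix.one_mulVec, Matrix.mulVec_sub,
        Matrix.mulVec_smul, h2, h3, sub_self, Matrix.mulVec_zero]

/-- If the compression `L E₀ X` is invertible, then `1 - (K + t (E₀ + t E₁))` has an inverse of order
`t⁻¹`, whose singular part acts through the projection `X L`. -/
theorem IsDominantSplitting.exists_inv_eq (h : IsDominantSplitting K L X)
    (h0 : (0 : 𝕜) ∉ spectrum 𝕜 (L * E₀ * X)) :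
    ∃ (R : 𝕜 → Matrix W W 𝕜) (R₀ : Matrix W W 𝕜), Tendsto R (𝓝[≠] 0) (𝓝 R₀) ∧
      ∀ᶠ t in 𝓝[≠] (0 : 𝕜), (1 - perturbed K E₀ E₁ t)⁻¹ =
        R t * (1 - X * L + t⁻¹ • (X * L)) := by
  have hdet := (h.det_rescaledPencil_zero_eq_zero_iff (E₀ := E₀) (E₁ := E₁) 0).not.2 h0
  have hc : Continuous fun t : 𝕜 => rescaledPencil K E₀ E₁ L X t 0 :=
    (continuous_rescaledPencil K E₀ E₁ L X).comp (continuous_id.prodMk continuous_const)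
  refine ⟨fun t => (rescaledPencil K E₀ E₁ L X t 0)⁻¹, (rescaledPencil K E₀ E₁ L X 0 0)⁻¹, ?_, ?_⟩
  · refine Tendsto.mono_left ?_ nhdsWithin_le_nhds
    simp only [Matrix.inv_def, Ring.inverse_eq_inv']
    exact ((hc.matrix_det.tendsto 0).inv₀ hdet).smul (hc.matrix_adjugate.tendsto 0)
  · filter_upwards [self_mem_nhdsWithin] with t ht
    have h1 := h.rescale_mul (E₀ := E₀) (E₁ := E₁) ht 0
    rw [mul_zero, add_zero, one_smul] at h1
    have hu := (Matrix.isUnit_iff_isUnit_det _).1 (h.isUnit_rescale ht)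
    rw [← h1, Matrix.mul_inv_rev, Matrix.mul_assoc, Matrix.nonsing_inv_mul _ hu, Matrix.mul_one]

end Field

section Complex

variable {K E₀ E₁ : Matrix W W ℂ} {L : Matrix m W ℂ} {X : Matrix W m ℂ}

/-- Every eigenvalue `l` of the compression `L E₀ X` is the first-order coefficient of an eigenvalue
of the perturbed matrix. -/
theorem IsDominantSplitting.eventually_exists_mem_spectrum (h : IsDominantSplitting K L X) {l : ℂ}
    (hl : l ∈ spectrum ℂ (L * E₀ * X)) {η : ℝ} (hη : 0 < η) :
    ∀ᶠ t in 𝓝[≠] (0 : ℂ), ∃ ζ : ℂ, ‖ζ - l‖ < η ∧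
      1 + t * ζ ∈ spectrum ℂ (perturbed K E₀ E₁ t) := by
  set G : ℂ → ℂ → ℂ := fun t ζ => (rescaledPencil K E₀ E₁ L X t ζ).det with hG
  have hGc : Continuous fun p : ℂ × ℂ => G p.1 p.2 :=
    (continuous_rescaledPencil K E₀ E₁ L X).matrix_det
  -- a small circle around `l` that avoids the spectrum of the compression
  have hfin : (spectrum ℂ (L * E₀ * X) \ {l}).Finite := (Matrix.finite_spectrum _).sdiff
  obtain ⟨r₀, hr₀, hball⟩ := Metric.isOpen_iff.1 hfin.isClosed.isOpen_compl l (by simp)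
  set r := min r₀ η / 2 with hr
  have hrpos : 0 < r := by positivity
  have hrr₀ : r < r₀ := (half_lt_self (lt_min hr₀ hη)).trans_le (min_le_left _ _)
  have hrη : r < η := (half_lt_self (lt_min hr₀ hη)).trans_le (min_le_right _ _)
  have hsphere : ∀ ζ ∈ Metric.sphere l r, G 0 ζ ≠ 0 := by
    intro ζ hζ h0
    have h1 := (h.det_rescaledPencil_zero_eq_zero_iff ζ).1 h0
    have h2 : ζ ∈ Metric.ball l r₀ := by
      rw [Metric.mem_ball, Metric.mem_sphere.1 hζ]
      exact hrr₀
    refine hball h2 ⟨h1, fun h3 => ?_⟩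
    rw [Set.mem_singleton_iff] at h3
    rw [h3, Metric.mem_sphere, dist_self] at hζ
    exact hrpos.ne hζ
  obtain ⟨c, hc, hcG⟩ : ∃ c > 0, ∀ ζ ∈ Metric.sphere l r, c < ‖G 0 ζ‖ := by
    have hne : (Metric.sphere l r).Nonempty := NormedSpace.sphere_nonempty.2 hrpos.le
    obtain ⟨ζ₀, hζ₀, hmin⟩ := (isCompact_sphere l r).exists_isMinOn hne
      ((hGc.comp (continuous_const.prodMk continuous_id)).norm.continuousOn (f := fun ζ => ‖G 0 ζ‖))
    have hpos := norm_pos_iff.2 (hsphere ζ₀ hζ₀)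
    exact ⟨‖G 0 ζ₀‖ / 2, half_pos hpos, fun ζ hζ => (half_lt_self hpos).trans_le (hmin hζ)⟩
  have hev1 : ∀ᶠ t in 𝓝 (0 : ℂ), ∀ ζ ∈ Metric.sphere l r, c < ‖G t ζ‖ := by
    refine (isCompact_sphere l r).eventually_forall_of_forall_eventually fun ζ hζ => ?_
    exact hGc.norm.continuousAt.eventually_const_lt (hcG ζ hζ)
  have hGl : G 0 l = 0 := (h.det_rescaledPencil_zero_eq_zero_iff l).2 hl
  have hev2 : ∀ᶠ t in 𝓝 (0 : ℂ), ‖G t l‖ < c := by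
    have : Continuous fun t => ‖G t l‖ := (hGc.comp (continuous_id.prodMk continuous_const)).norm
    refine this.continuousAt.eventually_lt_const ?_
    simpa [hGl] using hc
  filter_upwards [nhdsWithin_le_nhds hev1, nhdsWithin_le_nhds hev2, self_mem_nhdsWithin]
    with t h1 h2 ht
  -- otherwise `1 / G t` contradicts the maximum principle on the disc
  by_contra! hcon
  have hne : ∀ ζ ∈ Metric.closedBall l r, G t ζ ≠ 0 := by
    intro ζ hζ h0
    rw [Metric.mem_closedBall, dist_eq_norm] at hζ
    exact hcon ζ (hζ.trans_lt hrη) ((h.mem_spectrum_perturbed_iff ht ζ).2 h0)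
  have hd : DiffContOnCl ℂ (fun ζ => (G t ζ)⁻¹) (Metric.ball l r) := by
    refine DifferentiableOn.diffContOnCl fun ζ hζ => ?_
    rw [closure_ball l hrpos.ne'] at hζ
    exact ((differentiable_det_rescaledPencil K E₀ E₁ L X t ζ).inv
      (hne ζ hζ)).differentiableWithinAt
  have hmax : ‖(G t l)⁻¹‖ ≤ c⁻¹ := by
    refine Complex.norm_le_of_forall_mem_frontier_norm_le Metric.isBounded_ball hd (fun ζ hζ => ?_)
      (subset_closure (Metric.mem_ball_self hrpos))
    rw [frontier_ball l hrpos.ne'] at hζ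
    rw [norm_inv]
    exact inv_anti₀ hc (h1 ζ hζ).le
  rw [norm_inv] at hmax
  have hpos : 0 < ‖G t l‖ := norm_pos_iff.2 (hne l (Metric.mem_closedBall_self hrpos.le))
  exact absurd ((inv_le_inv₀ hpos hc).1 hmax) (not_le.2 h2)

/-- First-order upper bound for the modulus of the eigenvalues. Normalized eigenvectors of offending
eigenvalues accumulate at a fixed vector of `K`, and applying `L` identifies the limit of the
rescaled eigenvalues as an eigenvalue of `L E₀ X`. -/
theorem IsDominantSplitting.eventually_forall_norm_lt (h : IsDominantSplitting K L X) {c : ℝ}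
    (hc : ∀ l ∈ spectrum ℂ (L * E₀ * X), l.re < c) :
    ∀ᶠ α : ℝ in 𝓝[>] 0, ∀ l ∈ spectrum ℂ (perturbed K E₀ E₁ (α : ℂ)), ‖l‖ < 1 + α * c := by
  by_contra hcon
  have hfreq : ∃ᶠ α : ℝ in 𝓝[>] 0, (∃ p : ℂ × (W → ℂ), p.2 ∈ Metric.sphere (0 : W → ℂ) 1 ∧
      (perturbed K E₀ E₁ (α : ℂ)).mulVec p.2 = p.1 • p.2 ∧ 1 + α * c ≤ ‖p.1‖) ∧
      α ∈ Set.Ioc (0 : ℝ) 1 := by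
    refine ((not_eventually.1 hcon).mono fun α hα => ?_).and_eventually
      (Ioc_mem_nhdsGT one_pos)
    push Not at hα
    obtain ⟨l, hl, hlc⟩ := hα
    obtain ⟨v, hv0, hv⟩ := (mem_spectrum_iff_exists_mulVec_eq_smul _ _).1 hl
    refine ⟨(l, (‖v‖⁻¹ : ℂ) • v), ?_, ?_, hlc⟩
    · simp [norm_smul, hv0]
    · simp only [Matrix.mulVec_smul, hv, smul_comm l]
  obtain ⟨α, hα0, hα⟩ := exists_seq_forall_of_frequently hfreq
  choose hp hα1 using hα
  choose p hp1 hp2 hp3 using hp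
  have hcontM : Continuous fun q : ℝ × (W → ℂ) => (perturbed K E₀ E₁ (q.1 : ℂ)).mulVec q.2 := by
    unfold perturbed
    fun_prop
  obtain ⟨B, hB⟩ := ((isCompact_Icc (a := (0 : ℝ)) (b := 1)).prod
    (isCompact_sphere (0 : W → ℂ) 1)).exists_bound_of_continuousOn hcontM.continuousOn
  have hpB : ∀ n, p n ∈ Metric.closedBall (0 : ℂ) B ×ˢ Metric.sphere (0 : W → ℂ) 1 := by
    intro n
    refine ⟨?_, hp1 n⟩
    have h1 := hB (α n, (p n).2) ⟨Set.Ioc_subset_Icc_self (hα1 n), hp1 n⟩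
    rw [hp2, norm_smul, mem_sphere_zero_iff_norm.1 (hp1 n), mul_one] at h1
    simpa using h1
  obtain ⟨⟨l, v⟩, ⟨-, hv1⟩, g, hg, hlim⟩ :=
    ((isCompact_closedBall (0 : ℂ) B).prod (isCompact_sphere (0 : W → ℂ) 1)).tendsto_subseq hpB
  have hα0' : Tendsto (fun n => α (g n)) atTop (𝓝 0) :=
    (hα0.mono_right nhdsWithin_le_nhds).comp hg.tendsto_atTop
  have hl : Tendsto (fun n => (p (g n)).1) atTop (𝓝 l) := (continuous_fst.tendsto _).comp hlim
  have hv : Tendsto (fun n => (p (g n)).2) atTop (𝓝 v) := (continuous_snd.tendsto _).comp hlim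
  have hv0 : v ≠ 0 := by
    rintro rfl
    simp at hv1
  -- the limit is an eigenvector of `K` with an eigenvalue of modulus at least one
  have hKv : K.mulVec v = l • v := by
    have h1 := (hcontM.tendsto (0, v)).comp (hα0'.prodMk_nhds hv)
    have h2 := h1.congr fun n => hp2 (g n)
    simpa [perturbed] using tendsto_nhds_unique h2 (hl.smul hv)
  have hl1 : 1 ≤ ‖l‖ := by
    have h1 : Tendsto (fun n => 1 + α (g n) * c) atTop (𝓝 (1 + 0 * c)) :=
      (hα0'.mul_const c).const_add 1
    rw [zero_mul, add_zero] at h1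
    exact le_of_tendsto_of_tendsto' h1 hl.norm fun n => hp3 (g n)
  have hl_one := h.eq_one_of_mulVec_eq_smul hv0 hKv hl1
  rw [hl_one, one_smul] at hKv
  have hXL := h.eq_of_mulVec_eq hKv
  have hw0 : L.mulVec v ≠ 0 := fun h1 => hv0 (by rw [← hXL, h1, Matrix.mulVec_zero])
  -- the rescaled eigenvalues
  set ζ : ℕ → ℂ := fun n => ((p (g n)).1 - 1) / (α (g n) : ℂ) with hζ
  have hαne : ∀ n, (α (g n) : ℂ) ≠ 0 := fun n => by exact_mod_cast (hα1 (g n)).1.ne'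
  have hζl : ∀ n, (p (g n)).1 = 1 + α (g n) * ζ n := fun n => by
    have := hαne n
    simp only [hζ]
    field_simp
    ring
  have hζL : ∀ n, ζ n • L.mulVec (p (g n)).2 =
      L.mulVec ((E₀ + (α (g n) : ℂ) • E₁).mulVec (p (g n)).2) := by
    intro n
    have h1 := congrArg (L.mulVec ·) (hp2 (g n))
    simp only [perturbed, Matrix.add_mulVec (K), Matrix.mulVec_add, Matrix.mulVec_smul] at h1
    rw [Matrix.mulVec_mulVec, h.left_mul, hζl n, add_smul, one_smul, mul_smul,
      Matrix.smul_mulVec, Matrix.mulVec_smul] at h1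
    exact (smul_right_injective _ (hαne n) (add_left_cancel h1)).symm
  have hrhs : Tendsto (fun n => L.mulVec ((E₀ + (α (g n) : ℂ) • E₁).mulVec (p (g n)).2)) atTop
      (𝓝 (L.mulVec (E₀.mulVec v))) := by
    have hcont : Continuous fun q : ℝ × (W → ℂ) =>
        L.mulVec ((E₀ + (q.1 : ℂ) • E₁).mulVec q.2) := by
      fun_prop
    have h1 := (hcont.tendsto (0, v)).comp (hα0'.prodMk_nhds hv)
    simp only [Complex.ofReal_zero, zero_smul, add_zero] at h1
    exact h1
  have hLv : Tendsto (fun n => L.mulVec (p (g n)).2) atTop (𝓝 (L.mulVec v)) :=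
    ((continuous_const.matrix_mulVec continuous_id).tendsto v).comp hv
  obtain ⟨i, hi⟩ := Function.ne_iff.1 hw0
  obtain ⟨ν, hν⟩ : ∃ ν, Tendsto ζ atTop (𝓝 ν) := by
    refine ⟨_, ((tendsto_pi_nhds.1 hrhs i).div (tendsto_pi_nhds.1 hLv i) hi).congr' ?_⟩
    filter_upwards [(tendsto_pi_nhds.1 hLv i).eventually_ne hi] with n hn
    rw [Pi.div_apply, ← hζL n]
    exact mul_div_cancel_right₀ _ hn
  have hνmem : ν ∈ spectrum ℂ (L * E₀ * X) := by
    refine (mem_spectrum_iff_exists_mulVec_eq_smul _ _).2 ⟨L.mulVec v, hw0, ?_⟩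
    rw [← Matrix.mulVec_mulVec, hXL, ← Matrix.mulVec_mulVec]
    exact tendsto_nhds_unique (hrhs.congr fun n => (hζL n).symm) (hν.smul hLv)
  -- compare `‖1 + α ζ‖ ^ 2` with `(1 + α c) ^ 2` to first order in `α`
  have hfinal : Tendsto (fun n => 2 * ((ζ n).re - c) + α (g n) * (‖ζ n‖ ^ 2 - c ^ 2)) atTop
      (𝓝 (2 * (ν.re - c) + 0 * (‖ν‖ ^ 2 - c ^ 2))) :=
    ((((Complex.continuous_re.tendsto ν).comp hν).sub_const c).const_mul 2).add
      (hα0'.mul ((hν.norm.pow 2).sub_const _))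
  have hpos : ∀ᶠ n in atTop, 0 < 1 + α (g n) * c := by
    have h1 : Tendsto (fun n => 1 + α (g n) * c) atTop (𝓝 (1 + 0 * c)) :=
      (hα0'.mul_const c).const_add 1
    exact h1.eventually_const_lt (by simp)
  have hge : 0 ≤ 2 * (ν.re - c) + 0 * (‖ν‖ ^ 2 - c ^ 2) := by
    refine ge_of_tendsto hfinal (hpos.mono fun n hn => ?_)
    have h1 : (1 + α (g n) * c) ^ 2 ≤ ‖1 + (α (g n) : ℂ) * ζ n‖ ^ 2 := by
      rw [← hζl n]
      exact pow_le_pow_left₀ hn.le (hp3 (g n)) 2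
    have h2 : ‖1 + (α (g n) : ℂ) * ζ n‖ ^ 2 =
        1 + 2 * α (g n) * (ζ n).re + α (g n) ^ 2 * ‖ζ n‖ ^ 2 := by
      simp only [← Complex.normSq_eq_norm_sq, Complex.normSq_apply, Complex.add_re, Complex.add_im,
        Complex.one_re, Complex.one_im, Complex.re_ofReal_mul, Complex.im_ofReal_mul]
      ring
    have hαpos := (hα1 (g n)).1
    refine nonneg_of_mul_nonneg_right (a := α (g n)) ?_ hαpos
    nlinarith
  have := hc ν hνmem
  linarith

end Complex

end Perturbation

/-! ### Kronecker sums and the splitting of an ergodic chain -/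

section KroneckerSum

variable {m : Type*} [Fintype m] [DecidableEq m]

/-- The eigenvalues of a Kronecker sum are sums of two eigenvalues. The two summands commute, so they
have a common eigenvector in each eigenspace of the sum. -/
theorem exists_add_eq_of_mem_spectrum_kroneckerSum {M : Matrix m m ℂ} {l : ℂ}
    (hl : l ∈ spectrum ℂ (M ⊗ₖ (1 : Matrix m m ℂ) + (1 : Matrix m m ℂ) ⊗ₖ M)) :
    ∃ l₁ ∈ spectrum ℂ M, ∃ l₂ ∈ spectrum ℂ M, l₁ + l₂ = l := by
  set S := M ⊗ₖ (1 : Matrix m m ℂ) + (1 : Matrix m m ℂ) ⊗ₖ M with hS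
  set T := Matrix.toLin' (M ⊗ₖ (1 : Matrix m m ℂ)) with hT
  have hcomm : Commute S (M ⊗ₖ (1 : Matrix m m ℂ)) := by
    simp only [Commute, SemiconjBy, hS, Matrix.add_mul, Matrix.mul_add, ← Matrix.mul_kronecker_mul,
      Matrix.one_mul, Matrix.mul_one]
  have hmaps : ∀ v ∈ Module.End.eigenspace (Matrix.toLin' S) l,
      T v ∈ Module.End.eigenspace (Matrix.toLin' S) l := by
    intro v hv
    rw [Module.End.mem_eigenspace_iff, Matrix.toLin'_apply] at hv ⊢
    rw [hT, Matrix.toLin'_apply, Matrix.mulVec_mulVec, hcomm.eq, ← Matrix.mulVec_mulVec, hv,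
      Matrix.mulVec_smul]
  obtain ⟨v₀, hv₀, hSv₀⟩ := (mem_spectrum_iff_exists_mulVec_eq_smul _ _).1 hl
  have : Nontrivial (Module.End.eigenspace (Matrix.toLin' S) l) :=
    ⟨⟨⟨v₀, Module.End.mem_eigenspace_iff.2 (by simpa using hSv₀)⟩, 0,
      fun h => hv₀ (congrArg Subtype.val h)⟩⟩
  obtain ⟨l₁, hl₁⟩ := Module.End.exists_eigenvalue (T.restrict hmaps)
  obtain ⟨⟨v, hvS⟩, hv⟩ := hl₁.exists_hasEigenvector
  have hv0 : v ≠ 0 := fun h => hv.2 (Subtype.ext h)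
  have h1 : (M ⊗ₖ (1 : Matrix m m ℂ)).mulVec v = l₁ • v := by
    simpa [hT] using congrArg Subtype.val hv.apply_eq_smul
  have h2 : ((1 : Matrix m m ℂ) ⊗ₖ M).mulVec v = (l - l₁) • v := by
    rw [Module.End.mem_eigenspace_iff, Matrix.toLin'_apply, hS, Matrix.add_mulVec, h1] at hvS
    rw [sub_smul, ← hvS, add_sub_cancel_left]
  obtain ⟨⟨x, y⟩, hxy⟩ := Function.ne_iff.1 hv0
  refine ⟨l₁, (mem_spectrum_iff_exists_mulVec_eq_smul _ _).2
    ⟨fun a => v (a, y), fun h => hxy (congrFun h x), ?_⟩, l - l₁,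
    (mem_spectrum_iff_exists_mulVec_eq_smul _ _).2
    ⟨fun a => v (x, a), fun h => hxy (congrFun h y), ?_⟩, by ring⟩
  · ext a
    have := congrFun h1 (a, y)
    rwa [kronecker_one_mulVec_apply] at this
  · ext a
    have := congrFun h2 (x, a)
    simpa [Matrix.mulVec, dotProduct, Fintype.sum_prod_type, Matrix.one_apply] using this

theorem zero_mem_spectrum_complex {M : Matrix m m ℝ} (h : (0 : ℝ) ∈ spectrum ℝ M) :
    (0 : ℂ) ∈ spectrum ℂ (M.map ((↑) : ℝ → ℂ)) := by
  obtain ⟨v, hv, hMv⟩ := (mem_spectrum_iff_exists_mulVec_eq_smul _ _).1 h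
  refine (mem_spectrum_iff_exists_mulVec_eq_smul _ _).2 ⟨fun i => (v i : ℂ), fun h0 => hv ?_, ?_⟩
  · ext i
    have := congrFun h0 i
    simpa using this
  · ext i
    have := congrFun hMv i
    simp only [Matrix.mulVec, dotProduct, Matrix.map_apply, Pi.smul_apply, zero_smul] at this ⊢
    exact_mod_cast this

end KroneckerSum

section Splitting

theorem blockDiag_one {N m : Type*} [DecidableEq N] [DecidableEq m] : blockDiag (fun _ : N => (1 : Matrix m m ℝ)) = 1 := by
  ext ⟨i, x⟩ ⟨j, y⟩
  by_cases hi : i = j <;> by_cases hx : x = y <;> simp [blockDiag, Matrix.one_apply, hi, hx]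

theorem blockDiag_add {N m : Type*} [DecidableEq N] (G G' : N → Matrix m m ℝ) :
    blockDiag (fun i => G i + G' i) = blockDiag G + blockDiag G' := by
  ext ⟨i, x⟩ ⟨j, y⟩
  by_cases hi : i = j <;> simp [blockDiag, hi]

theorem blockDiag_smul {N m : Type*} [DecidableEq N] (c : ℝ) (G : N → Matrix m m ℝ) :
    blockDiag (fun i => c • G i) = c • blockDiag G := by
  ext ⟨i, x⟩ ⟨j, y⟩
  by_cases hi : i = j <;> simp [blockDiag, hi]

variable {N : Type*} {m : Type*} [DecidableEq m]

/-- `1ᵀ ⊗ I`: sums a stacked vector over the modes. -/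
def sumModes (N m : Type*) [DecidableEq m] : Matrix m (N × m) ℝ :=
  Matrix.of fun x y => if x = y.2 then 1 else 0

/-- `π ⊗ I`: distributes a vector over the modes according to `π`. -/
def spreadModes (m : Type*) [DecidableEq m] (π : N → ℝ) : Matrix (N × m) m ℝ :=
  Matrix.of fun x y => if x.2 = y then π x.1 else 0

variable [Fintype m]

/-- The complexification of a matrix. -/
abbrev toComplex {m n : Type*} (M : Matrix m n ℝ) : Matrix m n ℂ := M.map ((↑) : ℝ → ℂ)

theorem toComplex_mul {l m n : Type*} [Fintype m] (M : Matrix l m ℝ) (M' : Matrix m n ℝ) :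
    toComplex (M * M') = toComplex M * toComplex M' :=
  Matrix.map_mul (f := Complex.ofRealHom)

theorem toComplex_one {m : Type*} [DecidableEq m] : toComplex (1 : Matrix m m ℝ) = 1 :=
  Matrix.map_one _ Complex.ofReal_zero Complex.ofReal_one

theorem IsDominantSplitting.toComplex {W : Type*} [Fintype W] [DecidableEq W] {K : Matrix W W ℝ}
    {L : Matrix m W ℝ} {X : Matrix W m ℝ} (h : IsDominantSplitting K L X) :
    IsDominantSplitting (toComplex K) (MarkovTD.toComplex L) (MarkovTD.toComplex X) where
  left_mul := by rw [← toComplex_mul, h.left_mul]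
  mul_right := by rw [← toComplex_mul, h.mul_right]
  left_mul_right := by rw [← toComplex_mul, h.left_mul_right, toComplex_one]
  tendsto_pow := by
    rw [← toComplex_mul]
    have hc : Continuous fun M : Matrix W W ℝ => MarkovTD.toComplex M :=
      continuous_id.matrix_map Complex.continuous_ofReal
    refine ((hc.tendsto _).comp h.tendsto_pow).congr fun k => ?_
    exact Matrix.map_pow K Complex.ofRealHom k

theorem toComplex_perturbed {W : Type*} [Fintype W] [DecidableEq W] (K E₀ E₁ : Matrix W W ℝ)
    (α : ℝ) : toComplex (perturbed K E₀ E₁ α) =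
      perturbed (toComplex K) (toComplex E₀) (toComplex E₁) (α : ℂ) := by
  ext i j
  simp [perturbed]

variable [Fintype N] [DecidableEq N]

theorem kronecker_one_pow (B : Matrix N N ℝ) (k : ℕ) :
    (B ⊗ₖ (1 : Matrix m m ℝ)) ^ k = (B ^ k) ⊗ₖ 1 := by
  induction k with
  | zero => simp
  | succ k ih => rw [pow_succ, ih, ← Matrix.mul_kronecker_mul, Matrix.one_mul, pow_succ]

/-- For an ergodic chain, `Pᵀ ⊗ I` has the dominant eigenvalue `1` with fixed vectors `π ⊗ w`. -/
theorem isDominantSplitting_of_ergodic {P : Matrix N N ℝ} (hP : P ∈ Matrix.rowStochastic ℝ N)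
    {π : N → ℝ} (hπ : Matrix.vecMul π P = π) (hπ1 : ∑ i, π i = 1)
    (herg : ∀ i j, Tendsto (fun k : ℕ => (P ^ k) i j) atTop (𝓝 (π j))) :
    IsDominantSplitting (P.transpose ⊗ₖ (1 : Matrix m m ℝ)) (sumModes N m) (spreadModes m π) where
  left_mul := by
    ext x ⟨i, y⟩
    have := Matrix.sum_row_of_mem_rowStochastic hP i
    by_cases h : x = y <;>
    simp [Matrix.mul_apply, Fintype.sum_prod_type, sumModes, Matrix.one_apply, h, this]
  mul_right := by
    ext ⟨j, y⟩ x
    have := congrFun hπ j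
    simp only [Matrix.vecMul, dotProduct] at this
    by_cases h : y = x <;>
    simp [Matrix.mul_apply, Fintype.sum_prod_type, spreadModes, Matrix.one_apply, h,
      ← this, mul_comm]
  left_mul_right := by
    ext x y
    by_cases h : x = y <;>
    simp [Matrix.mul_apply, Fintype.sum_prod_type, spreadModes, sumModes, Matrix.one_apply, h, hπ1]
  tendsto_pow := by
    refine tendsto_pi_nhds.2 fun ⟨j, y⟩ => tendsto_pi_nhds.2 fun ⟨i, y'⟩ => ?_
    simp only [kronecker_one_pow, ← Matrix.transpose_pow, Matrix.kroneckerMap_apply,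
      Matrix.transpose_apply]
    have : (spreadModes m π * sumModes N m) (j, y) (i, y') =
        π j * (1 : Matrix m m ℝ) y y' := by
      simp [Matrix.mul_apply, spreadModes, sumModes, Matrix.one_apply]
    rw [this]
    exact (herg i j).mul_const _

/-- Compressing a block diagonal matrix averages its blocks. -/
theorem sumModes_mul_blockDiag_mul_spreadModes (G : N → Matrix m m ℝ) (π : N → ℝ) :
    sumModes N m * blockDiag G * spreadModes m π = ∑ i, π i • G i := by
  ext x y
  rw [Matrix.mul_assoc, Matrix.mul_apply, Fintype.sum_prod_type, Matrix.sum_apply]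
  refine Finset.sum_congr rfl fun i _ => ?_
  have h : ∀ z, (blockDiag G * spreadModes m π) (i, z) y = π i * G i z y := by
    intro z
    rw [Matrix.mul_apply, Fintype.sum_prod_type, Finset.sum_eq_single i]
    · simp [blockDiag, spreadModes, mul_comm]
    · intro j _ hj
      simp [blockDiag, Ne.symm hj]
    · simp
  simp [h, sumModes]

end Splitting

/-! ### Small learning rates -/

section SmallLearningRate

theorem sum_smul_kroneckerSum {N : Type*} [Fintype N] {d : ℕ} (A : N → Matrix (Fin d) (Fin d) ℝ) (π : N → ℝ) :
    ∑ i, π i • (A i ⊗ₖ (1 : Matrix (Fin d) (Fin d) ℝ) + (1 : Matrix (Fin d) (Fin d) ℝ) ⊗ₖ A i) =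
      Abar A π ⊗ₖ (1 : Matrix (Fin d) (Fin d) ℝ) + (1 : Matrix (Fin d) (Fin d) ℝ) ⊗ₖ Abar A π := by
  ext ⟨a, b⟩ ⟨c, e⟩
  simp only [Matrix.sum_apply, Matrix.smul_apply, Matrix.add_apply, Matrix.kroneckerMap_apply,
    smul_eq_mul, Abar, Finset.sum_mul, Finset.mul_sum, ← Finset.sum_add_distrib]
  exact Finset.sum_congr rfl fun i _ => by ring

variable {N : Type*} [Fintype N] [DecidableEq N] {d : ℕ}

theorem H11_eq_perturbed (P : Matrix N N ℝ) (A : N → Matrix (Fin d) (Fin d) ℝ) (α : ℝ) :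
    H11 P A α = perturbed (P.transpose ⊗ₖ (1 : Matrix (Fin d) (Fin d) ℝ))
      ((P.transpose ⊗ₖ (1 : Matrix (Fin d) (Fin d) ℝ)) * blockDiag A) 0 α := by
  have h : blockDiag (Hi A α) = 1 + α • blockDiag A := by
    rw [← blockDiag_one, ← blockDiag_smul, ← blockDiag_add]
    rfl
  rw [H11, h, perturbed, smul_zero, add_zero, Matrix.mul_add, Matrix.mul_one, Matrix.mul_smul]

theorem H22_eq_perturbed (P : Matrix N N ℝ) (A : N → Matrix (Fin d) (Fin d) ℝ) (α : ℝ) :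
    H22 P A α = perturbed (P.transpose ⊗ₖ (1 : Matrix (Fin d × Fin d) (Fin d × Fin d) ℝ))
      ((P.transpose ⊗ₖ (1 : Matrix (Fin d × Fin d) (Fin d × Fin d) ℝ)) *
        blockDiag (fun i => A i ⊗ₖ 1 + 1 ⊗ₖ A i))
      ((P.transpose ⊗ₖ (1 : Matrix (Fin d × Fin d) (Fin d × Fin d) ℝ)) *
        blockDiag (fun i => A i ⊗ₖ A i)) α := by
  have h : blockDiag (fun i => Hi A α i ⊗ₖ Hi A α i) =
      1 + α • (blockDiag (fun i => A i ⊗ₖ 1 + 1 ⊗ₖ A i) +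
        α • blockDiag (fun i => A i ⊗ₖ A i)) := by
    rw [← blockDiag_one, ← blockDiag_smul, ← blockDiag_add, ← blockDiag_smul, ← blockDiag_add]
    congr 1
    ext i : 1
    simp only [Hi, Matrix.add_kronecker, Matrix.kronecker_add, Matrix.smul_kronecker,
      Matrix.kronecker_smul, Matrix.one_kronecker_one, smul_add]
    abel
  rw [H22, h, perturbed, Matrix.mul_add, Matrix.mul_one, Matrix.mul_smul, Matrix.mul_add,
    Matrix.mul_smul]

variable {P : Matrix N N ℝ} {A : N → Matrix (Fin d) (Fin d) ℝ} {π : N → ℝ}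

/-- The compression of `K D`, for `K` with dominant splitting and a block diagonal `D`. -/
theorem compression_blockDiag {m : Type*} [Fintype m] [DecidableEq m]
    (h : IsDominantSplitting (P.transpose ⊗ₖ (1 : Matrix m m ℝ)) (sumModes N m) (spreadModes m π))
    (G : N → Matrix m m ℝ) :
    sumModes N m * ((P.transpose ⊗ₖ (1 : Matrix m m ℝ)) * blockDiag G) * spreadModes m π =
      ∑ i, π i • G i := by
  rw [← Matrix.mul_assoc, h.left_mul, sumModes_mul_blockDiag_mul_spreadModes]

theorem exists_add_eq_of_mem_spectrum_toComplex_kroneckerSum {M : Matrix (Fin d) (Fin d) ℝ} {l : ℂ}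
    (hl : l ∈ spectrum ℂ (toComplex (M ⊗ₖ (1 : Matrix (Fin d) (Fin d) ℝ) +
      (1 : Matrix (Fin d) (Fin d) ℝ) ⊗ₖ M))) :
    ∃ l₁ ∈ spectrum ℂ (toComplex M), ∃ l₂ ∈ spectrum ℂ (toComplex M), l₁ + l₂ = l := by
  have h : toComplex (M ⊗ₖ (1 : Matrix (Fin d) (Fin d) ℝ) +
      (1 : Matrix (Fin d) (Fin d) ℝ) ⊗ₖ M) = toComplex M ⊗ₖ (1 : Matrix (Fin d) (Fin d) ℂ) +
        (1 : Matrix (Fin d) (Fin d) ℂ) ⊗ₖ toComplex M := by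
    ext ⟨a, b⟩ ⟨c, e⟩
    simp [Matrix.one_apply, apply_ite ((↑) : ℝ → ℂ)]
  rw [h] at hl
  exact exists_add_eq_of_mem_spectrum_kroneckerSum hl

theorem eventually_forall_spectrum_H11_lt
    (h : IsDominantSplitting (P.transpose ⊗ₖ (1 : Matrix (Fin d) (Fin d) ℝ))
      (sumModes N (Fin d)) (spreadModes (Fin d) π)) {c : ℝ}
    (hc : ∀ l ∈ spectrum ℂ (toComplex (Abar A π)), l.re < c) :
    ∀ᶠ α : ℝ in 𝓝[>] 0, ∀ l ∈ spectrum ℂ (toComplex (H11 P A α)), ‖l‖ < 1 + α * c := by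
  simp only [H11_eq_perturbed, toComplex_perturbed]
  refine h.toComplex.eventually_forall_norm_lt ?_
  rw [← toComplex_mul, ← toComplex_mul, compression_blockDiag h]
  exact hc

theorem eventually_forall_spectrum_H22_lt
    (h : IsDominantSplitting (P.transpose ⊗ₖ (1 : Matrix (Fin d × Fin d) (Fin d × Fin d) ℝ))
      (sumModes N (Fin d × Fin d)) (spreadModes (Fin d × Fin d) π)) {c : ℝ}
    (hc : ∀ l₁ ∈ spectrum ℂ (toComplex (Abar A π)), ∀ l₂ ∈ spectrum ℂ (toComplex (Abar A π)),
      l₁.re + l₂.re < c) :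
    ∀ᶠ α : ℝ in 𝓝[>] 0, ∀ l ∈ spectrum ℂ (toComplex (H22 P A α)), ‖l‖ < 1 + α * c := by
  simp only [H22_eq_perturbed, toComplex_perturbed]
  refine h.toComplex.eventually_forall_norm_lt ?_
  rw [← toComplex_mul, ← toComplex_mul, compression_blockDiag h, sum_smul_kroneckerSum]
  intro l hl
  obtain ⟨l₁, hl₁, l₂, hl₂, rfl⟩ := exists_add_eq_of_mem_spectrum_toComplex_kroneckerSum hl
  exact hc l₁ hl₁ l₂ hl₂

theorem eventually_specRad_H22_lt_one
    (h : IsDominantSplitting (P.transpose ⊗ₖ (1 : Matrix (Fin d × Fin d) (Fin d × Fin d) ℝ))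
      (sumModes N (Fin d × Fin d)) (spreadModes (Fin d × Fin d) π))
    (hA : IsHurwitz (Abar A π)) : ∀ᶠ α : ℝ in 𝓝[>] 0, specRad (H22 P A α) < 1 := by
  filter_upwards [eventually_forall_spectrum_H22_lt h (c := 0)
    fun l₁ hl₁ l₂ hl₂ => add_neg (hA l₁ hl₁) (hA l₂ hl₂)] with α hα
  exact specRad_lt one_pos fun l hl => by simpa using hα l hl

theorem specRad_Hfull_isLittleO
    (h1 : IsDominantSplitting (P.transpose ⊗ₖ (1 : Matrix (Fin d) (Fin d) ℝ))
      (sumModes N (Fin d)) (spreadModes (Fin d) π))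
    (h2 : IsDominantSplitting (P.transpose ⊗ₖ (1 : Matrix (Fin d × Fin d) (Fin d × Fin d) ℝ))
      (sumModes N (Fin d × Fin d)) (spreadModes (Fin d × Fin d) π))
    (hA : IsHurwitz (Abar A π)) (b : N → Fin d → ℝ) {l : ℂ} (hl : IsMaxReEigenvalue (Abar A π) l) :
    (fun α : ℝ => specRad (Hfull P A b α) - (1 + l.re * α)) =o[𝓝[>] 0] (fun α : ℝ => α) := by
  refine isLittleO_iff.2 fun c hc => ?_
  have hpos : ∀ᶠ α : ℝ in 𝓝[>] 0, 0 < 1 + α * (l.re + c) := by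
    have : Continuous fun α : ℝ => 1 + α * (l.re + c) := by fun_prop
    exact nhdsWithin_le_nhds (this.continuousAt.eventually_const_lt (by simp))
  have hcast : Tendsto (fun α : ℝ => (α : ℂ)) (𝓝[>] 0) (𝓝[≠] 0) := by
    refine tendsto_nhdsWithin_iff.2 ⟨?_, ?_⟩
    · exact (Complex.continuous_ofReal.tendsto' 0 0 (by simp)).mono_left nhdsWithin_le_nhds
    · filter_upwards [self_mem_nhdsWithin] with α hα
      exact Complex.ofReal_ne_zero.2 (ne_of_gt hα)
  have hl' : l ∈ spectrum ℂ (toComplex (sumModes N (Fin d)) *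
      toComplex ((P.transpose ⊗ₖ (1 : Matrix (Fin d) (Fin d) ℝ)) * blockDiag A) *
      toComplex (spreadModes (Fin d) π)) := by
    rw [← toComplex_mul, ← toComplex_mul, compression_blockDiag h1]
    exact hl.1
  have hlow := hcast.eventually (h1.toComplex.eventually_exists_mem_spectrum
    (E₁ := toComplex 0) hl' hc)
  -- the first-order coefficients for `H₂₂` are sums of two eigenvalues of `Ā`, both with negative
  -- real part, so their real parts stay below `l.re`
  filter_upwards [hpos, hlow,
    eventually_forall_spectrum_H11_lt h1 (c := l.re + c) fun l' hl' => by
      linarith [hl.2 l' hl'],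
    eventually_forall_spectrum_H22_lt h2 (c := l.re + c) fun l₁ hl₁ l₂ hl₂ => by
      linarith [hl.2 l₁ hl₁, hA l₂ hl₂],
    self_mem_nhdsWithin] with α hα ⟨ζ, hζ, hmem⟩ hH11 hH22 (hα0 : 0 < α)
  have hup := specRad_Hfull_lt (b := b) hα hH11 hH22
  rw [← toComplex_perturbed, ← H11_eq_perturbed] at hmem
  have hdown := norm_le_specRad_Hfull (b := b) hmem
  have hre : 1 + α * ζ.re ≤ ‖1 + (α : ℂ) * ζ‖ := by
    simpa using Complex.re_le_norm (1 + (α : ℂ) * ζ)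
  have hζre : l.re - c ≤ ζ.re := by
    have := (abs_le.1 ((Complex.abs_re_le_norm (ζ - l)).trans hζ.le)).1
    rw [Complex.sub_re] at this
    linarith
  have := mul_le_mul_of_nonneg_left hζre hα0.le
  rw [Real.norm_eq_abs, Real.norm_of_nonneg hα0.le, abs_le]
  constructor <;> nlinarith

/-- The stationary mean square error is of order `α`: both resolvents are of order `α⁻¹`, but the
singular part of the first one is annihilated because `∑ π_i b_i = 0`. -/
theorem deltaInf_isBigO (hP : P ∈ Matrix.rowStochastic ℝ N)
    (h1 : IsDominantSplitting (P.transpose ⊗ₖ (1 : Matrix (Fin d) (Fin d) ℝ))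
      (sumModes N (Fin d)) (spreadModes (Fin d) π))
    (h2 : IsDominantSplitting (P.transpose ⊗ₖ (1 : Matrix (Fin d × Fin d) (Fin d × Fin d) ℝ))
      (sumModes N (Fin d × Fin d)) (spreadModes (Fin d × Fin d) π))
    (hA : IsHurwitz (Abar A π)) {b : N → Fin d → ℝ} (hb : ∑ i, π i • b i = 0) :
    (fun α : ℝ => deltaInf P A b π α) =O[𝓝[>] 0] (fun α : ℝ => α) := by
  obtain ⟨R₁, R₁₀, hR₁, hinv₁⟩ := h1.exists_inv_eq
    (E₀ := (P.transpose ⊗ₖ (1 : Matrix (Fin d) (Fin d) ℝ)) * blockDiag A) (E₁ := 0) (by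
      rw [compression_blockDiag h1]
      intro h0
      simpa using hA 0 (zero_mem_spectrum_complex h0))
  obtain ⟨R₂, R₂₀, hR₂, hinv₂⟩ := h2.exists_inv_eq
    (E₀ := (P.transpose ⊗ₖ (1 : Matrix (Fin d × Fin d) (Fin d × Fin d) ℝ)) *
      blockDiag (fun i => A i ⊗ₖ 1 + 1 ⊗ₖ A i))
    (E₁ := (P.transpose ⊗ₖ (1 : Matrix (Fin d × Fin d) (Fin d × Fin d) ℝ)) *
      blockDiag (fun i => A i ⊗ₖ A i)) (by
      rw [compression_blockDiag h2, sum_smul_kroneckerSum]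
      intro h0
      obtain ⟨l₁, hl₁, l₂, hl₂, h⟩ :=
        exists_add_eq_of_mem_spectrum_toComplex_kroneckerSum (zero_mem_spectrum_complex h0)
      have := add_neg (hA l₁ hl₁) (hA l₂ hl₂)
      rw [← Complex.add_re, h] at this
      simp at this)
  have hle : 𝓝[>] (0 : ℝ) ≤ 𝓝[≠] 0 := nhdsWithin_mono _ fun x hx => ne_of_gt hx
  set w₁ := ((P.transpose * Matrix.diagonal π) ⊗ₖ
    (1 : Matrix (Fin d) (Fin d) ℝ)).mulVec (bStack b) with hw₁
  set w₂ := ((P.transpose * Matrix.diagonal π) ⊗ₖ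
    (1 : Matrix (Fin d × Fin d) (Fin d × Fin d) ℝ)).mulVec (bbStack b) with hw₂
  set Q₂ := spreadModes (Fin d × Fin d) π * sumModes N (Fin d × Fin d) with hQ₂
  have hLw : (sumModes N (Fin d)).mulVec w₁ = 0 := by
    ext a
    have hb' := congrFun hb a
    simp only [Finset.sum_apply, Pi.smul_apply, smul_eq_mul, Pi.zero_apply] at hb'
    have : (sumModes N (Fin d)).mulVec w₁ a = ∑ j, ∑ i, P i j * π i * b i a := by
      simp [Matrix.mulVec, dotProduct, Fintype.sum_prod_type, sumModes, hw₁, bStack,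
        Matrix.one_apply, Matrix.mul_diagonal]
    rw [this, Finset.sum_comm]
    simp only [mul_assoc, ← Finset.sum_mul, Matrix.sum_row_of_mem_rowStochastic hP, one_mul, hb',
      Pi.zero_apply]
  have hq : ∀ᶠ α in 𝓝[>] (0 : ℝ), qInf P A b π α = α • (R₁ α).mulVec w₁ := by
    filter_upwards [hle hinv₁] with α hα
    rw [qInf, H11_eq_perturbed, hα, ← Matrix.mulVec_mulVec]
    congr 2
    rw [Matrix.add_mulVec, Matrix.sub_mulVec, Matrix.smul_mulVec, Matrix.one_mulVec,
      ← Matrix.mulVec_mulVec, hLw, Matrix.mulVec_zero, smul_zero, sub_zero, add_zero]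
  -- `H₂₁` with its factor `α` removed
  set F : ℝ → Matrix (N × (Fin d × Fin d)) (N × Fin d) ℝ :=
    fun α => Matrix.of fun x y => P y.1 x.1 * Sblock A b α y.1 x.2 y.2 with hF
  have hH21 : ∀ α, H21 P A b α = α • F α := fun α => rfl
  have hFc : Continuous F := by
    refine continuous_pi fun x => continuous_pi fun y => ?_
    simp only [hF, Matrix.of_apply, Sblock, Matrix.add_apply, colKron, kronCol, Hi,
      Matrix.smul_apply, smul_eq_mul]
    fun_prop
  set g : ℝ → N × (Fin d × Fin d) → ℝ := fun α =>
    (R₂ α).mulVec ((α • (1 - Q₂) + Q₂).mulVec ((F α).mulVec ((R₁ α).mulVec w₁) + w₂)) with hg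
  have hvec : ∀ᶠ α in 𝓝[>] (0 : ℝ), vecQInf P A b π α = α • g α := by
    filter_upwards [hle hinv₂, hq, self_mem_nhdsWithin] with α hα hqα (hα0 : 0 < α)
    have e1 : (α ^ 2)⁻¹ • (H21 P A b α).mulVec (qInf P A b π α) =
        (F α).mulVec ((R₁ α).mulVec w₁) := by
      rw [hqα, hH21, Matrix.smul_mulVec, Matrix.mulVec_smul, smul_smul, smul_smul]
      rw [show (α ^ 2)⁻¹ * α * α = 1 by field_simp, one_smul]
    have e2 : ∀ Q, α ^ 2 • (R₂ α * (1 - Q + α⁻¹ • Q)) = α • (R₂ α * (α • (1 - Q) + Q)) := by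
      intro Q
      rw [← Matrix.mul_smul, ← Matrix.mul_smul, smul_add, smul_add, smul_smul, smul_smul]
      congr 3
      · ring
      · field_simp
    rw [vecQInf, e1, H22_eq_perturbed, hα, ← Matrix.smul_mulVec, e2, hg, Matrix.smul_mulVec]
    simp only [← Matrix.mulVec_mulVec]
    rfl
  have hid : Tendsto (fun α : ℝ => α) (𝓝[>] 0) (𝓝 0) := tendsto_id.mono_left nhdsWithin_le_nhds
  have hmv : ∀ {m n : Type _} [Fintype m] [Fintype n] {M : ℝ → Matrix m n ℝ} {M₀ : Matrix m n ℝ}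
      {v : ℝ → n → ℝ} {v₀ : n → ℝ}, Tendsto M (𝓝[>] 0) (𝓝 M₀) → Tendsto v (𝓝[>] 0) (𝓝 v₀) →
      Tendsto (fun α => (M α).mulVec (v α)) (𝓝[>] 0) (𝓝 (M₀.mulVec v₀)) :=
    fun hM hv => ((continuous_fst.matrix_mulVec continuous_snd).tendsto (_, _)).comp
      (hM.prodMk_nhds hv)
  obtain ⟨g₀, hg₀⟩ : ∃ g₀, Tendsto g (𝓝[>] 0) (𝓝 g₀) :=
    ⟨_, hmv (hR₂.mono_left hle) (hmv ((hid.smul_const _).add_const _)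
      ((hmv ((hFc.tendsto 0).mono_left nhdsWithin_le_nhds)
        (hmv (hR₁.mono_left hle) tendsto_const_nhds)).add_const w₂))⟩
  set e : N × (Fin d × Fin d) → ℝ :=
    fun x => (1 : ℝ) * Matrix.vec (1 : Matrix (Fin d) (Fin d) ℝ) x.2 with he
  have heg : Tendsto (fun α => e ⬝ᵥ g α) (𝓝[>] 0) (𝓝 (e ⬝ᵥ g₀)) :=
    ((continuous_const.dotProduct continuous_id).tendsto g₀).comp hg₀
  have hδ : (fun α : ℝ => deltaInf P A b π α) =ᶠ[𝓝[>] 0] fun α => α * (e ⬝ᵥ g α) := by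
    filter_upwards [hvec] with α hα
    rw [deltaInf, hα, dotProduct_smul, smul_eq_mul]
  refine hδ.trans_isBigO ?_
  simpa using (isBigO_refl (fun α : ℝ => α) (𝓝[>] 0)).mul (heg.isBigO_one ℝ)

end SmallLearningRate

end MarkovTD

open MarkovTD
theorem mainTheorem4
    {Ω : Type*} [mΩ : MeasurableSpace Ω] (μ : Measure Ω) [IsProbabilityMeasure μ]
    {S N : Type*} [Fintype N] [DecidableEq N] {d : ℕ}
    -- TD(0) data
    (φ : S → EuclideanSpace ℝ (Fin d)) (r : S → ℝ) (γ : ℝ)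
    (θstar : EuclideanSpace ℝ (Fin d)) (θ₀ : Ω → EuclideanSpace ℝ (Fin d))
    -- the jump process `z`, whose value at time `k` encodes the transition `(s^k, s^{k+1})`
    (cur nxt : N → S) (s : ℕ → Ω → S) (z : ℕ → Ω → N)
    (hs : ∀ k ω, s k ω = cur (z k ω) ∧ s (k + 1) ω = nxt (z k ω))
    (P : Matrix N N ℝ) (hP : P ∈ Matrix.rowStochastic ℝ N)
    (ℱ : Filtration ℕ mΩ) (hz : IsMarkovChain μ ℱ P z)
    (hθ₀ : StronglyMeasurable[ℱ 0] θ₀) (hθ₀' : MemLp θ₀ 2 μ)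
    -- the limiting (stationary) distribution
    (π : N → ℝ) (hπ : Matrix.vecMul π P = π)
    (hp : Tendsto (law μ z) atTop (𝓝 π))
    -- `θ*` solves `∑ π_i b_i = 0`, and `Ā` is Hurwitz
    (hb : ∑ i, π i • tdb φ r γ θstar cur nxt i = 0)
    (hA : IsHurwitz (Abar (tdA φ γ cur nxt) π)) :
    let A := tdA φ γ cur nxt
    let b := tdb φ r γ θstar cur nxt
    let ξ : ℝ → ℕ → Ω → EuclideanSpace ℝ (Fin d) :=
      fun α k ω => tdIter φ r γ s θ₀ α k ω - θstar
    -- exact limits and convergence rate for a fixed learning rate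
    (∀ α : ℝ, 0 < α → specRad (H22 P A α) < 1 →
      (IsUnit (1 - H11 P A α) ∧ IsUnit (1 - H22 P A α) ∧
        Tendsto (qVec μ z (ξ α)) atTop (𝓝 (qInf P A b π α)) ∧
        Tendsto (vecQ μ z (ξ α)) atTop (𝓝 (vecQInf P A b π α)) ∧
        Tendsto (fun k => ∫ ω, ‖ξ α k ω‖ ^ 2 ∂μ) atTop (𝓝 (deltaInf P A b π α))) ∧
      (∀ C ρ : ℝ, (∀ k, ‖law μ z k - π‖ ≤ C * ρ ^ k) →
        ∀ ε : ℝ, 0 < ε → ∃ C₀ : ℝ, ∀ k : ℕ,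
          deltaInf P A b π α - C₀ * max (specRad (Hfull P A b α) + ε) ρ ^ k
              ≤ ∫ ω, ‖ξ α k ω‖ ^ 2 ∂μ ∧
          ∫ ω, ‖ξ α k ω‖ ^ 2 ∂μ
              ≤ deltaInf P A b π α + C₀ * max (specRad (Hfull P A b α) + ε) ρ ^ k)) ∧
    -- small learning rates, for an ergodic chain
    ((∀ i j, Tendsto (fun k : ℕ => (P ^ k) i j) atTop (𝓝 (π j))) →
      (∀ᶠ α : ℝ in 𝓝[>] 0, specRad (H22 P A α) < 1) ∧
      (fun α : ℝ => deltaInf P A b π α) =O[𝓝[>] 0] (fun α : ℝ => α) ∧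
      (∀ l : ℂ, IsMaxReEigenvalue (Abar A π) l →
        (fun α : ℝ => specRad (Hfull P A b α) - (1 + l.re * α)) =o[𝓝[>] 0] (fun α : ℝ => α))) := by
  intro A b ξ
  have hstep : ∀ α k ω a, ξ α (k + 1) ω a =
      ∑ c, Hi A α (z k ω) a c * ξ α k ω c + α * b (z k ω) a := fun α k ω a =>
    tdIter_error_succ_apply φ r γ θstar hs θ₀ α k ω a
  have h0 : ∀ α a, StronglyMeasurable[ℱ 0] (fun ω => ξ α 0 ω a) ∧
      MemLp (fun ω => ξ α 0 ω a) 2 μ := by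
    intro α a
    have h1 : StronglyMeasurable[ℱ 0] (fun ω => θ₀ ω - θstar) := hθ₀.sub stronglyMeasurable_const
    have h2 : MemLp (fun ω => θ₀ ω - θstar) 2 μ := hθ₀'.sub (memLp_const _)
    exact ⟨(EuclideanSpace.proj (𝕜 := ℝ) a).continuous.comp_stronglyMeasurable h1,
      (EuclideanSpace.proj (𝕜 := ℝ) a).comp_memLp' h2⟩
  refine ⟨fun α hα hσ => ⟨⟨isUnit_one_sub_of_specRad_lt_one (specRad_H11_lt_one hP A hσ),
    isUnit_one_sub_of_specRad_lt_one hσ,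
    moments_tendsto hz (hstep α) (h0 α) hα.ne' hP hσ hp⟩, fun C ρ hC ε hε => ?_⟩, fun herg => ?_⟩
  · obtain ⟨C₀, hC₀⟩ := abs_integral_norm_sq_sub_deltaInf_le hz (hstep α) (h0 α) hα.ne' hP hσ hC hε
    refine ⟨C₀, fun k => ?_⟩
    obtain ⟨h1, h2⟩ := abs_le.1 (hC₀ k)
    constructor <;> linarith
  · have hN : Nonempty N := by
      obtain ⟨ω⟩ : Nonempty Ω := μ.nonempty_of_neZero
      exact ⟨z 0 ω⟩
    -- the rows of `P ^ k` sum to one, and so does their limit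
    have hπ1 : ∑ i, π i = 1 := by
      obtain ⟨i⟩ := hN
      have h1 : Tendsto (fun k : ℕ => ∑ j, (P ^ k) i j) atTop (𝓝 (∑ j, π j)) :=
        tendsto_finsetSum _ fun j _ => herg i j
      simp only [fun k : ℕ => Matrix.sum_row_of_mem_rowStochastic (pow_mem hP k) i] at h1
      exact tendsto_nhds_unique h1 tendsto_const_nhds
    have h1 := isDominantSplitting_of_ergodic (m := Fin d) hP hπ hπ1 herg
    have h2 := isDominantSplitting_of_ergodic (m := Fin d × Fin d) hP hπ hπ1 herg
    exact ⟨eventually_specRad_H22_lt_one h2 hA, deltaInf_isBigO hP h1 h2 hA hb,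
      fun l hl => specRad_Hfull_isLittleO h1 h2 hA b hl⟩
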